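/- Let $\bar x\in\mathbb R^n$, let $a_1,\dots,a_m$ be i.i.d. standard Gaussian vectors in $\mathbb R^n$, let $y[r]=(a_r^\top\bar x)^2$, $f(x)=\frac1{4m}\sum_{r=1}^m\big((a_r^\top x)^2-y[r]\big)^2$, $\overline{\mathcal X}=\{\bar x,-\bar x\}$, and $\operatorname{dist}(x,\overline{\mathcal X})=\min(\|x-\bar x\|,\|x+\bar x\|)$. For $r>0$ put $B(\overline{\mathcal X},r)=\{x:\operatorname{dist}(x,\overline{\mathcal X})<r\}$. Let $\psi(x)=\frac14\|x\|^4+\frac12\|x\|^2$ and $\Theta(\rho)=\sup_{\|x-\bar x\|\le\rho}\|\nabla^2\psi(x)\|$ (operator norm). A spectral initialiser $x_0$ is an eigenvector for the largest eigenvalue of $Y=\frac1m\sum_r y[r]\,a_ra_r^\top$, scaled to the norm $\sqrt{n\sum_r y[r]/\sum_r\|a_r\|^2}$. **Lemma.** The function $\eta_1(\varrho)=\sqrt{2-2\sqrt{1-\varrho}}+\varrho/2$ is a strictly increasing bijection from $]0,1[$ onto $]0,\sqrt2+\frac12[$. There is a numerical constant $\zeta>0$ such that for every $\varrho\in\,]0,1[$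 there is a constant $C(\varrho)>0$, depending only on $\varrho$, such that for all $n,m$ and $\bar x\in\mathbb R^n$ with $m\ge C(\varrho)\,n\log n$, there is an event of probability at least $$1-2e^{-\frac{m(\sqrt{1+\varrho}-1)^2}{8}}-5e^{-\zeta n}-\frac4{n^2}$$ on which every spectral initialiser $x_0$ satisfies: (i) $\operatorname{dist}(x_0,\overline{\mathcal X})\le\eta_1(\varrho)\|\bar x\|$; (ii) $f(x_0)\le\big(3+\varrho\max(\|\bar x\|^2/3,1)\big)\,\frac{\Theta(\eta_1(\varrho)\|\bar x\|)}2\,\eta_1(\varrho)^2\|\bar x\|^2$; (iii) if $\bar x\ne0$, then for every $\lambda\in\,]0,1[$ such that $$\varrho\le\eta_1^{-1}\!\left(\frac{1-\lambda}{\sqrt{3\big(6(1+(1-\lambda)^2/3)+1\big)}}\cdot\frac1{\max(\|\bar x\|,1)}\right),$$ one has $x_0\in B\Big(\overline{\mathcal X},\frac{\rho}{\max(\sqrt{\Theta(\rho)},1)}\Big)$ with $\rho=\frac{1-\lambda}{\sqrt3}\|\bar x\|$. -/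

import Mathlib

open MeasureTheory ProbabilityTheory Set

noncomputable section

namespace PhaseRetrieval

/-- The measurements `y[r] = |⟨a_r, xbar⟩|²`. -/
def measurements {n m : ℕ} (a : Fin m → EuclideanSpace ℝ (Fin n))
    (xbar : EuclideanSpace ℝ (Fin n)) : Fin m → ℝ :=
  fun r => (inner ℝ (a r) xbar) ^ 2

/-- The objective `f(x) = (1/4m) ∑_r (|⟨a_r, x⟩|² - y[r])²`. -/
def objective {n m : ℕ} (a : Fin m → EuclideanSpace ℝ (Fin n)) (y : Fin m → ℝ)
    (x : EuclideanSpace ℝ (Fin n)) : ℝ :=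
  (1 / (4 * (m : ℝ))) * ∑ r, ((inner ℝ (a r) x) ^ 2 - y r) ^ 2

/-- The entropy `ψ(x) = ‖x‖⁴ / 4 + ‖x‖² / 2`. -/
def entropy {n : ℕ} (x : EuclideanSpace ℝ (Fin n)) : ℝ :=
  (1 / 4) * ‖x‖ ^ 4 + (1 / 2) * ‖x‖ ^ 2

/-- The Hessian of a function, as the derivative of its gradient. -/
def hessian {n : ℕ} (g : EuclideanSpace ℝ (Fin n) → ℝ) (x : EuclideanSpace ℝ (Fin n)) :
    EuclideanSpace ℝ (Fin n) →L[ℝ] EuclideanSpace ℝ (Fin n) :=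
  fderiv ℝ (gradient g) x

/-- `Θ(ρ)`: the supremum over the ball of radius `ρ` around `xbar` of the operator norm of the
Hessian of the entropy. -/
def Theta {n : ℕ} (xbar : EuclideanSpace ℝ (Fin n)) (ρ : ℝ) : ℝ :=
  sSup ((fun x => ‖hessian entropy x‖) '' Metric.closedBall xbar ρ)

/-- The distance from `x` to the set `{xbar, -xbar}` of true vectors. -/
def distTrue {n : ℕ} (xbar x : EuclideanSpace ℝ (Fin n)) : ℝ :=
  min ‖x - xbar‖ ‖x + xbar‖

/-- The (open) ball of radius `r` around the set `{xbar, -xbar}` of true vectors. -/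
def ballTrue {n : ℕ} (xbar : EuclideanSpace ℝ (Fin n)) (r : ℝ) :
    Set (EuclideanSpace ℝ (Fin n)) :=
  {x | distTrue xbar x < r}

/-- The matrix `Y = (1/m) ∑_r y[r] a_r a_rᵀ`, as an operator. -/
def spectralMatrix {n m : ℕ} (a : Fin m → EuclideanSpace ℝ (Fin n)) (y : Fin m → ℝ) :
    EuclideanSpace ℝ (Fin n) →L[ℝ] EuclideanSpace ℝ (Fin n) :=
  (1 / (m : ℝ)) • ∑ r, y r • InnerProductSpace.rankOne ℝ (a r) (a r)

/-- `u` is a top eigenvector of `T`: an eigenvector for the largest eigenvalue. -/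
def IsTopEigenvector {n : ℕ} (T : EuclideanSpace ℝ (Fin n) →L[ℝ] EuclideanSpace ℝ (Fin n))
    (u : EuclideanSpace ℝ (Fin n)) : Prop :=
  ∃ μ : ℝ, Module.End.HasEigenvector (T : Module.End ℝ (EuclideanSpace ℝ (Fin n))) μ u ∧
    ∀ ν : ℝ, Module.End.HasEigenvalue (T : Module.End ℝ (EuclideanSpace ℝ (Fin n))) ν → ν ≤ μ

/-- The norm `√(n ∑_r y[r] / ∑_r ‖a_r‖²)` to which the initial point is scaled. -/
def spectralScale {n m : ℕ} (a : Fin m → EuclideanSpace ℝ (Fin n)) (y : Fin m → ℝ) : ℝ :=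
  √((n : ℝ) * (∑ r, y r) / ∑ r, ‖a r‖ ^ 2)

/-- `x₀` is an output of spectral initialization on the input `(a, y)`: a unit top eigenvector
of `Y`, scaled to the prescribed norm. The output is not unique (sign, multiplicity), hence a
predicate. -/
def IsSpectralInit {n m : ℕ} (a : Fin m → EuclideanSpace ℝ (Fin n)) (y : Fin m → ℝ)
    (x₀ : EuclideanSpace ℝ (Fin n)) : Prop :=
  ∃ u : EuclideanSpace ℝ (Fin n), ‖u‖ = 1 ∧ IsTopEigenvector (spectralMatrix a y) u ∧
    x₀ = spectralScale a y • u

/-- `η₁(ϱ) = √(2 - 2 √(1 - ϱ)) + ϱ / 2`. -/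
def eta1 (ϱ : ℝ) : ℝ := √(2 - 2 * √(1 - ϱ)) + ϱ / 2

/-- The inverse of `η₁` as a function on `]0, 1[`. -/
def eta1Inv (t : ℝ) : ℝ := Function.invFunOn eta1 (Ioo 0 1) t

/-- The threshold whose preimage by `η₁` bounds `ϱ` in the last claim. -/
def initThreshold {n : ℕ} (xbar : EuclideanSpace ℝ (Fin n)) (lam : ℝ) : ℝ :=
  (1 - lam) / √(3 * (6 * (1 + (1 - lam) ^ 2 / 3) + 1)) * (1 / max ‖xbar‖ 1)

/-- The radius `(1 - λ) / √3 * ‖xbar‖` of local relative strong convexity. -/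
def localRadius {n : ℕ} (xbar : EuclideanSpace ℝ (Fin n)) (lam : ℝ) : ℝ :=
  (1 - lam) / √3 * ‖xbar‖

end PhaseRetrieval

end

noncomputable section

namespace PhaseRetrieval

open scoped ENNReal NNReal

/-! ### Exponential moments of a standard Gaussian variable -/

/-! Write `xbar = R e` with `‖e‖ = 1`, `α_r = ⟨e, a_r⟩`, and let `b_r` be the component of `a_r`
orthogonal to `e`. Along `e ⊕ e^⊥` the matrix `Y / R²` has corner `(1/m) ∑ α_r⁴`, close to 3,
off-diagonal block `w = (1/m) ∑ α_r³ b_r`, close to 0, and lower block `(1/m) ∑ α_r² b_r b_rᵀ`,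
close to the identity. Only a gap is needed: corner at least 11/4, lower block of norm at most 9/4.
The top eigenvalue then exceeds the lower block by 1/2, so a unit top eigenvector has orthogonal
component `v` of norm at most `2‖w‖`. Together with concentration of the scale this gives (i), with
an arbitrarily small constant in place of `η₁(ϱ)`.

Claim (ii) is harder: `f` is quartic, and with `m` of order `n log n` the bound `|⟨b_r, v⟩| ≤ ‖b_r‖
‖v‖` is too weak. A leave-one-out argument (`IsGood.abs_inner_perp_le`) shows instead that `v` is
nearly orthogonal to every `b_s`. The equation `μ v = f v + z`, with `f` built without measurement
`s`, is expanded in a truncated Neumann series. The vectors `f^k w_s`, with `w_s` the off-diagonal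
block without measurement `s`, are independent of `a_s` and do not involve `μ`, so Gaussian tails
bound all the products `⟨b_s, f^k w_s⟩`. Summing the resulting estimate costs only a sixth moment of
the `α_r`, and `Θ ≥ 3‖xbar‖² + 1` absorbs the constants.

Claim (iii) is (i) plus a computation: the Hessian of `ψ` at `x` has norm at most `3‖x‖² + 1`, and
the threshold is what makes `η₁(ϱ)‖xbar‖` fit in the ball.

All random input is gathered in `IsGood`, which fails with probability at most `11/m²`. This is
below `4/n²`, so the exponential terms are needed only as slack when `n ≤ 1`. -/

lemma lintegral_gaussianReal_ofReal {f : ℝ → ℝ} (hf : Measurable f) :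
    ∫⁻ x, ENNReal.ofReal (f x) ∂(gaussianReal 0 1) =
      ∫⁻ x, ENNReal.ofReal ((√(2 * Real.pi))⁻¹ * (Real.exp (-(x ^ 2) / 2) * f x)) := by
  rw [gaussianReal_of_var_ne_zero 0 one_ne_zero,
    lintegral_withDensity_eq_lintegral_mul _ (measurable_gaussianPDF 0 1) hf.ennreal_ofReal]
  refine lintegral_congr fun x => ?_
  simp only [Pi.mul_apply, gaussianPDF, gaussianPDFReal]
  rw [← ENNReal.ofReal_mul (by positivity)]
  simp [mul_assoc]

lemma lintegral_exp_mul_sq_gaussianReal {θ : ℝ} (hθ : θ < 1 / 2) :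
    ∫⁻ x, ENNReal.ofReal (Real.exp (θ * x ^ 2)) ∂(gaussianReal 0 1) =
      ENNReal.ofReal (√(1 - 2 * θ))⁻¹ := by
  have hb : 0 < 1 / 2 - θ := by linarith
  rw [lintegral_gaussianReal_ofReal (by fun_prop)]
  have h : ∀ x : ℝ, (√(2 * Real.pi))⁻¹ * (Real.exp (-(x ^ 2) / 2) * Real.exp (θ * x ^ 2)) =
      (√(2 * Real.pi))⁻¹ * Real.exp (-(1 / 2 - θ) * x ^ 2) := by
    intro x
    rw [← Real.exp_add]
    congr 2
    ring
  simp_rw [h]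
  rw [← ofReal_integral_eq_lintegral_ofReal ((integrable_exp_neg_mul_sq hb).const_mul _)
    (Filter.Eventually.of_forall fun x => by positivity), integral_const_mul, integral_gaussian]
  congr 1
  have : Real.pi / (1 / 2 - θ) = (2 * Real.pi) / (1 - 2 * θ) := by
    field_simp
  rw [this, Real.sqrt_div (by positivity)]
  have h2 : √(2 * Real.pi) ≠ 0 := by positivity
  field_simp

/-- First-order Taylor expansion of `log (1 - y)` at `y = 2θ`, with remainder at most `y² / (1 -
|y|) ≤ 2 y²`. It is valid for both signs of `θ`, so it serves both tails. -/
lemma inv_sqrt_one_sub_le_exp {θ : ℝ} (hθ : |θ| ≤ 1 / 4) :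
    (√(1 - 2 * θ))⁻¹ ≤ Real.exp (θ + 4 * θ ^ 2) := by
  obtain ⟨h1, h2⟩ := abs_le.1 hθ
  have hy : |2 * θ| ≤ 1 / 2 := by rw [abs_mul]; norm_num; linarith
  have hpos : 0 < 1 - 2 * θ := by linarith
  have := Real.abs_log_sub_add_sum_range_le (x := 2 * θ) (by linarith) 1
  simp only [Finset.range_one, Finset.sum_singleton] at this
  norm_num at this
  have h3 : |2 * θ| ^ 2 / (1 - |2 * θ|) ≤ 8 * θ ^ 2 := by
    rw [div_le_iff₀ (by linarith), sq_abs]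
    nlinarith [sq_nonneg θ]
  have h4 : -(8 * θ ^ 2) ≤ 2 * θ + Real.log (1 - 2 * θ) := by
    have h5 := (abs_le.1 this).1
    have h6 : 2 * |θ| = |2 * θ| := by rw [abs_mul]; norm_num
    have h7 : (2 * θ) ^ 2 = |2 * θ| ^ 2 := (sq_abs _).symm
    rw [h6] at h5
    have h8 : (2 * θ) ^ 2 / (1 - |2 * θ|) ≤ 8 * θ ^ 2 := by rw [h7]; exact h3
    linarith
  have h9 : Real.exp (-(θ + 4 * θ ^ 2)) ≤ √(1 - 2 * θ) := by
    apply Real.le_sqrt_of_sq_le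
    rw [← Real.exp_nat_mul, ← Real.le_log_iff_exp_le hpos]
    push_cast
    linarith
  rw [inv_le_comm₀ (Real.sqrt_pos.2 hpos) (Real.exp_pos _), ← Real.exp_neg]
  exact h9

/-- Sub-exponential bound for the square of a standard Gaussian. -/
lemma lintegral_exp_mul_sq_gaussianReal_le {θ : ℝ} (hθ : |θ| ≤ 1 / 4) :
    ∫⁻ x, ENNReal.ofReal (Real.exp (θ * x ^ 2)) ∂(gaussianReal 0 1) ≤
      ENNReal.ofReal (Real.exp (θ + 4 * θ ^ 2)) := by
  rw [lintegral_exp_mul_sq_gaussianReal (by linarith [(abs_le.1 hθ).2])]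
  exact ENNReal.ofReal_le_ofReal (inv_sqrt_one_sub_le_exp hθ)

lemma lintegral_exp_quarter_sq_gaussianReal_le :
    ∫⁻ x, ENNReal.ofReal (Real.exp (x ^ 2 / 4)) ∂(gaussianReal 0 1) ≤ ENNReal.ofReal (3 / 2) := by
  have := lintegral_exp_mul_sq_gaussianReal (θ := 1 / 4) (by norm_num)
  simp_rw [show ∀ x : ℝ, x ^ 2 / 4 = 1 / 4 * x ^ 2 from fun x => by ring]
  rw [this]
  apply ENNReal.ofReal_le_ofReal
  rw [inv_le_comm₀ (by positivity) (by norm_num)]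
  exact Real.le_sqrt_of_sq_le (by norm_num)

lemma integrable_pow_gaussianReal (k : ℕ) :
    Integrable (fun x : ℝ => x ^ k) (gaussianReal 0 1) := by
  have := (memLp_id_gaussianReal (μ := 0) (v := 1) (k : ℝ≥0)).integrable_norm_pow'
  exact (integrable_norm_iff (by fun_prop)).1 (by simpa using this)

/-- Crude moment bounds suffice for the sixth and eighth powers: a single Taylor term of the
exponential dominates each power by `K e^{x²/4}`, whose weight integrates to `√2 ≤ 3/2`. The fourth
moment is computed exactly, because it has to beat 11/4. -/
lemma integral_le_of_lintegral_exp_quarter_sq {f : ℝ → ℝ} (hf : Integrable f (gaussianReal 0 1))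
    (hf0 : ∀ x, 0 ≤ f x) {K : ℝ} (hK : 0 ≤ K) (h : ∀ x, f x ≤ K * Real.exp (x ^ 2 / 4)) :
    ∫ x, f x ∂(gaussianReal 0 1) ≤ K * (3 / 2) := by
  rw [← ENNReal.ofReal_le_ofReal_iff (by positivity),
    ofReal_integral_eq_lintegral_ofReal hf (Filter.Eventually.of_forall hf0)]
  calc _ ≤ ∫⁻ x, ENNReal.ofReal K * ENNReal.ofReal (Real.exp (x ^ 2 / 4)) ∂(gaussianReal 0 1) := by
        refine lintegral_mono fun x => ?_
        rw [← ENNReal.ofReal_mul hK]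
        exact ENNReal.ofReal_le_ofReal (h x)
    _ ≤ _ := by
        rw [lintegral_const_mul _ (by fun_prop), ENNReal.ofReal_mul hK]
        gcongr
        exact lintegral_exp_quarter_sq_gaussianReal_le

lemma integral_pow_six_gaussianReal_le : ∫ x, x ^ 6 ∂(gaussianReal 0 1) ≤ 600 := by
  refine (integral_le_of_lintegral_exp_quarter_sq (K := 400) (integrable_pow_gaussianReal 6)
    (fun x => by positivity) (by norm_num) fun x => ?_).trans (by norm_num)
  have := Real.pow_div_factorial_le_exp (x := x ^ 2 / 4) (by positivity) 3
  norm_num [Nat.factorial] at this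
  nlinarith [Real.exp_pos (x ^ 2 / 4)]

lemma integral_pow_eight_gaussianReal_le : ∫ x, x ^ 8 ∂(gaussianReal 0 1) ≤ 10000 := by
  refine (integral_le_of_lintegral_exp_quarter_sq (K := 6200) (integrable_pow_gaussianReal 8)
    (fun x => by positivity) (by norm_num) fun x => ?_).trans (by norm_num)
  have := Real.pow_div_factorial_le_exp (x := x ^ 2 / 4) (by positivity) 4
  norm_num [Nat.factorial] at this
  nlinarith [Real.exp_pos (x ^ 2 / 4)]

lemma integral_pow_four_gaussianReal : ∫ x, x ^ 4 ∂(gaussianReal 0 1) = 3 := by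
  have h0 : integrableExpSet id (gaussianReal 0 1) = Set.univ := integrableExpSet_id_gaussianReal
  have h := iteratedDeriv_mgf_zero (X := id) (μ := gaussianReal 0 1) (by simp [h0]) 4
  simp only [Pi.pow_apply, id_eq] at h
  rw [← h, mgf_id_gaussianReal]
  have e0 : ∀ t : ℝ, HasDerivAt (fun t : ℝ => Real.exp (t ^ 2 / 2)) (t * Real.exp (t ^ 2 / 2)) t := by
    intro t
    have := ((hasDerivAt_pow 2 t).div_const 2).exp
    refine this.congr_deriv ?_
    push_cast
    ring
  have e1 : deriv (fun t : ℝ => Real.exp (t ^ 2 / 2)) = fun t => t * Real.exp (t ^ 2 / 2) :=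
    funext fun t => (e0 t).deriv
  have e2 : deriv (fun t : ℝ => t * Real.exp (t ^ 2 / 2)) =
      fun t => (t ^ 2 + 1) * Real.exp (t ^ 2 / 2) := by
    funext t
    refine (((hasDerivAt_id t).mul (e0 t)).congr_deriv ?_).deriv
    simp only [id_eq]
    ring
  have e3 : deriv (fun t : ℝ => (t ^ 2 + 1) * Real.exp (t ^ 2 / 2)) =
      fun t => (t ^ 3 + 3 * t) * Real.exp (t ^ 2 / 2) := by
    funext t
    refine ((((hasDerivAt_pow 2 t).add_const 1).mul (e0 t)).congr_deriv ?_).deriv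
    push_cast
    ring
  have e4 : deriv (fun t : ℝ => (t ^ 3 + 3 * t) * Real.exp (t ^ 2 / 2)) =
      fun t => (t ^ 4 + 6 * t ^ 2 + 3) * Real.exp (t ^ 2 / 2) := by
    funext t
    refine ((((hasDerivAt_pow 3 t).add ((hasDerivAt_id t).const_mul 3)).mul
      (e0 t)).congr_deriv ?_).deriv
    simp only [id_eq, Pi.add_apply]
    push_cast
    ring
  simp only [zero_mul, NNReal.coe_one, one_mul, zero_add, iteratedDeriv_succ, iteratedDeriv_zero,
    e1, e2, e3, e4]
  simp

/-- The fourth power has no positive exponential moment, but only its lower tail is needed, and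
there `e^{-y} ≤ 1 - y + y²/2` reduces the question to the fourth and eighth moments. -/
lemma lintegral_exp_neg_mul_pow_four_gaussianReal_le {θ : ℝ} (hθ : 0 ≤ θ) :
    ∫⁻ x, ENNReal.ofReal (Real.exp (-(θ * x ^ 4))) ∂(gaussianReal 0 1) ≤
      ENNReal.ofReal (Real.exp (-(3 * θ) + 5000 * θ ^ 2)) := by
  have hi : Integrable (fun x : ℝ => 1 - θ * x ^ 4 + θ ^ 2 / 2 * x ^ 8) (gaussianReal 0 1) :=
    ((integrable_const _).sub ((integrable_pow_gaussianReal 4).const_mul _)).add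
      ((integrable_pow_gaussianReal 8).const_mul _)
  have hle : ∀ x : ℝ, Real.exp (-(θ * x ^ 4)) ≤ 1 - θ * x ^ 4 + θ ^ 2 / 2 * x ^ 8 := by
    intro x
    have hy : 0 ≤ θ * x ^ 4 := by positivity
    have hq := Real.quadratic_le_exp_of_nonneg hy
    have h1 : Real.exp (-(θ * x ^ 4)) * Real.exp (θ * x ^ 4) = 1 := by
      rw [← Real.exp_add]
      simp
    have h2 : 1 - θ * x ^ 4 + θ ^ 2 / 2 * x ^ 8 = 1 - θ * x ^ 4 + (θ * x ^ 4) ^ 2 / 2 := by ring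
    rw [h2]
    set y := θ * x ^ 4
    have h3 : 0 < 1 - y + y ^ 2 / 2 := by nlinarith [sq_nonneg (y - 1)]
    have h4 : 1 ≤ (1 - y + y ^ 2 / 2) * Real.exp y := by
      refine le_trans ?_ (mul_le_mul_of_nonneg_left hq h3.le)
      nlinarith [sq_nonneg (y ^ 2)]
    exact le_of_mul_le_mul_right (h1.trans_le h4) (Real.exp_pos y)
  calc _ ≤ ∫⁻ x, ENNReal.ofReal (1 - θ * x ^ 4 + θ ^ 2 / 2 * x ^ 8) ∂(gaussianReal 0 1) :=
        lintegral_mono fun x => ENNReal.ofReal_le_ofReal (hle x)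
    _ = ENNReal.ofReal (∫ x, (1 - θ * x ^ 4 + θ ^ 2 / 2 * x ^ 8) ∂(gaussianReal 0 1)) :=
        (ofReal_integral_eq_lintegral_ofReal hi (Filter.Eventually.of_forall fun x =>
          (Real.exp_pos _).le.trans (hle x))).symm
    _ ≤ _ := by
        apply ENNReal.ofReal_le_ofReal
        have hs : Integrable (fun x : ℝ => 1 - θ * x ^ 4) (gaussianReal 0 1) :=
          (integrable_const _).sub ((integrable_pow_gaussianReal 4).const_mul _)
        rw [integral_add hs ((integrable_pow_gaussianReal 8).const_mul _),
          integral_sub (integrable_const _) ((integrable_pow_gaussianReal 4).const_mul _),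
          integral_const_mul, integral_const_mul, integral_pow_four_gaussianReal]
        simp only [integral_const, probReal_univ, smul_eq_mul, one_mul]
        have := integral_pow_eight_gaussianReal_le
        nlinarith [Real.add_one_le_exp (-(3 * θ) + 5000 * θ ^ 2), sq_nonneg θ]

/-- Exponential moment of the truncated sixth power. -/
lemma lintegral_exp_indicator_pow_six_gaussianReal_le {θ L : ℝ} (hθ : 0 ≤ θ) (hL : θ * L ^ 3 ≤ 1) :
    ∫⁻ x : ℝ, ENNReal.ofReal (Real.exp (if x ^ 2 ≤ L then θ * x ^ 6 else 0)) ∂(gaussianReal 0 1) ≤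
      ENNReal.ofReal (Real.exp (1200 * θ)) := by
  have hi : Integrable (fun x : ℝ => 1 + 2 * θ * x ^ 6) (gaussianReal 0 1) :=
    (integrable_const _).add ((integrable_pow_gaussianReal 6).const_mul _)
  calc _ ≤ ∫⁻ x, ENNReal.ofReal (1 + 2 * θ * x ^ 6) ∂(gaussianReal 0 1) := by
        refine lintegral_mono fun x => ENNReal.ofReal_le_ofReal ?_
        split_ifs with h
        -- The truncation keeps the exponent in `[0, 1]`, where `e^y ≤ 1 + 2 y`; hence 1200 = 2 ·
        -- 600.
        · have h1 : θ * x ^ 6 ≤ 1 := by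
            refine le_trans ?_ hL
            have : x ^ 6 = (x ^ 2) ^ 3 := by ring
            rw [this]
            gcongr
          have h0 : 0 ≤ θ * x ^ 6 := by positivity
          have := Real.abs_exp_sub_one_le (x := θ * x ^ 6) (by rwa [abs_of_nonneg h0])
          rw [abs_of_nonneg h0] at this
          linarith [(abs_le.1 this).2]
        · rw [Real.exp_zero]
          have : 0 ≤ 2 * θ * x ^ 6 := by positivity
          linarith
    _ = ENNReal.ofReal (∫ x, (1 + 2 * θ * x ^ 6) ∂(gaussianReal 0 1)) :=
        (ofReal_integral_eq_lintegral_ofReal hi (Filter.Eventually.of_forall fun x => by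
          positivity)).symm
    _ ≤ _ := by
        apply ENNReal.ofReal_le_ofReal
        rw [integral_add (integrable_const _) ((integrable_pow_gaussianReal 6).const_mul _),
          integral_const_mul]
        simp only [integral_const, probReal_univ, smul_eq_mul, one_mul]
        have := integral_pow_six_gaussianReal_le
        nlinarith [Real.add_one_le_exp (1200 * θ)]

/-! ### Marginals of the standard Gaussian measure -/

section Marginals

variable {E : Type*} [NormedAddCommGroup E] [InnerProductSpace ℝ E] [FiniteDimensional ℝ E]
  [MeasurableSpace E] [BorelSpace E]

lemma map_inner_stdGaussian (f : E) :
    (stdGaussian E).map (fun x => inner ℝ f x) = gaussianReal 0 (‖f‖₊ ^ 2) := by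
  have h := IsGaussian.map_eq_gaussianReal (μ := stdGaussian E) (innerSL ℝ f)
  rw [integral_strongDual_stdGaussian, variance_dual_stdGaussian, innerSL_apply_norm] at h
  have h2 : (‖f‖ ^ 2).toNNReal = ‖f‖₊ ^ 2 := by
    ext
    simp
  rw [← h2, ← h]
  rfl

lemma indepFun_inner_stdGaussian {e f : E} (hef : inner ℝ e f = 0) :
    IndepFun (fun x => inner ℝ e x) (fun x => inner ℝ f x) (stdGaussian E) := by
  have hG : HasGaussianLaw (fun x : E => (inner ℝ e x, inner ℝ f x)) (stdGaussian E) :=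
    (IsGaussian.hasGaussianLaw_id (μ := stdGaussian E)).map_fun ((innerSL ℝ e).prod (innerSL ℝ f))
  refine hG.indepFun_of_covariance_eq_zero ?_
  rw [← covarianceBilin_apply_eq_cov IsGaussian.memLp_two_id, covarianceBilin_stdGaussian]
  exact hef

lemma map_inner_pair_stdGaussian {e f : E} (hef : inner ℝ e f = 0) :
    (stdGaussian E).map (fun x => (inner ℝ e x, inner ℝ f x)) =
      (gaussianReal 0 (‖e‖₊ ^ 2)).prod (gaussianReal 0 (‖f‖₊ ^ 2)) := by
  have h := (indepFun_iff_map_prod_eq_prod_map_map (by fun_prop) (by fun_prop)).1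
    (indepFun_inner_stdGaussian hef)
  rw [h, map_inner_stdGaussian, map_inner_stdGaussian]

lemma lintegral_inner_stdGaussian (f : E) {F : ℝ → ℝ≥0∞} (hF : Measurable F) :
    ∫⁻ x, F (inner ℝ f x) ∂(stdGaussian E) = ∫⁻ t, F (‖f‖ * t) ∂(gaussianReal 0 1) := by
  have h := gaussianReal_map_const_mul (μ := 0) (v := 1) ‖f‖
  have h2 : gaussianReal (‖f‖ * 0) (.mk (‖f‖ ^ 2) (sq_nonneg _) * 1) = gaussianReal 0 (‖f‖₊ ^ 2) := by
    congr 1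
    · simp
    · ext; simp
  rw [← lintegral_map (f := F) hF (by fun_prop), map_inner_stdGaussian, ← h2, ← h,
    lintegral_map hF (by fun_prop)]

lemma lintegral_inner_unit_stdGaussian {e : E} (he : ‖e‖ = 1) {F : ℝ → ℝ≥0∞} (hF : Measurable F) :
    ∫⁻ x, F (inner ℝ e x) ∂(stdGaussian E) = ∫⁻ t, F t ∂(gaussianReal 0 1) := by
  rw [lintegral_inner_stdGaussian e hF, he]
  simp

lemma lintegral_inner_pair_stdGaussian {e f : E} (he : ‖e‖ = 1) (hef : inner ℝ e f = 0)
    {F : ℝ → ℝ → ℝ≥0∞} (hF : Measurable fun p : ℝ × ℝ => F p.1 p.2) :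
    ∫⁻ x, F (inner ℝ e x) (inner ℝ f x) ∂(stdGaussian E) =
      ∫⁻ s, ∫⁻ t, F s (‖f‖ * t) ∂(gaussianReal 0 1) ∂(gaussianReal 0 1) := by
  rw [show ∫⁻ x, F (inner ℝ e x) (inner ℝ f x) ∂(stdGaussian E) =
      ∫⁻ p, F p.1 p.2 ∂((stdGaussian E).map fun x => (inner ℝ e x, inner ℝ f x)) from
    (lintegral_map (f := fun p : ℝ × ℝ => F p.1 p.2)
      (g := fun x : E => ((inner ℝ e x : ℝ), (inner ℝ f x : ℝ))) hF (by fun_prop)).symm,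
    map_inner_pair_stdGaussian hef, lintegral_prod _ hF.aemeasurable]
  have h1 : gaussianReal 0 (‖e‖₊ ^ 2) = gaussianReal 0 1 := by
    congr 1; ext; simp [he]
  rw [h1]
  refine lintegral_congr fun s => ?_
  have hs : Measurable (F s) := hF.comp (measurable_const.prodMk measurable_id)
  rw [← map_inner_stdGaussian f, lintegral_map hs (by fun_prop), lintegral_inner_stdGaussian f hs]

/-- The exponential moment of the square of a one-dimensional marginal. -/
lemma lintegral_exp_inner_sq_le {f : E} (hf : ‖f‖ ≤ 1) {θ : ℝ} (h0 : 0 ≤ θ) (hθ : θ ≤ 1 / 4) :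
    ∫⁻ x, ENNReal.ofReal (Real.exp (θ * (inner ℝ f x) ^ 2)) ∂(stdGaussian E) ≤
      ENNReal.ofReal (Real.exp (θ + 4 * θ ^ 2)) := by
  rw [lintegral_inner_stdGaussian f (F := fun t => ENNReal.ofReal (Real.exp (θ * t ^ 2)))
    (by fun_prop)]
  refine le_trans (lintegral_mono fun t => ?_)
    (lintegral_exp_mul_sq_gaussianReal_le (by rwa [abs_of_nonneg h0]))
  refine ENNReal.ofReal_le_ofReal (Real.exp_le_exp.2 (mul_le_mul_of_nonneg_left ?_ h0))
  rw [mul_pow]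
  exact mul_le_of_le_one_left (sq_nonneg _) (pow_le_one₀ (norm_nonneg _) hf)

/-- Self-normalised exponential moment of `α³ Z` with `α`, `Z` independent Gaussians. -/
lemma lintegral_exp_cube_mul_le {e f : E} (he : ‖e‖ = 1) (hf : ‖f‖ ≤ 1) (hef : inner ℝ e f = 0)
    (θ : ℝ) :
    ∫⁻ x, ENNReal.ofReal (Real.exp (θ * ((inner ℝ e x) ^ 3 * inner ℝ f x) -
      θ ^ 2 / 2 * (inner ℝ e x) ^ 6)) ∂(stdGaussian E) ≤ ENNReal.ofReal (Real.exp 0) := by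
  rw [lintegral_inner_pair_stdGaussian he hef
    (F := fun s t => ENNReal.ofReal (Real.exp (θ * (s ^ 3 * t) - θ ^ 2 / 2 * s ^ 6))) (by fun_prop)]
  -- With the first Gaussian frozen at `s` the exponent is linear in the second one, whose standard
  -- deviation is `‖f‖ ≤ 1`; the subtracted term dominates its log-moment.
  have key : ∀ s : ℝ, ∫⁻ t, ENNReal.ofReal (Real.exp (θ * (s ^ 3 * (‖f‖ * t)) -
      θ ^ 2 / 2 * s ^ 6)) ∂(gaussianReal 0 1) ≤ 1 := by
    intro s
    have hexp : ∀ t : ℝ, Real.exp (θ * (s ^ 3 * (‖f‖ * t)) - θ ^ 2 / 2 * s ^ 6) =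
        Real.exp (-(θ ^ 2 / 2 * s ^ 6)) * Real.exp ((θ * s ^ 3 * ‖f‖) * t) := by
      intro t
      rw [← Real.exp_add]
      ring_nf
    simp_rw [hexp]
    rw [← ofReal_integral_eq_lintegral_ofReal
      ((integrable_exp_mul_gaussianReal _).const_mul _)
      (Filter.Eventually.of_forall fun x => by positivity), integral_const_mul]
    have hm : ∫ t, Real.exp ((θ * s ^ 3 * ‖f‖) * t) ∂(gaussianReal 0 1) =
        Real.exp ((θ * s ^ 3 * ‖f‖) ^ 2 / 2) := by
      have := congrFun (mgf_id_gaussianReal (μ := 0) (v := 1)) (θ * s ^ 3 * ‖f‖)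
      simpa [mgf] using this
    rw [hm, ← Real.exp_add, ← ENNReal.ofReal_one]
    apply ENNReal.ofReal_le_ofReal
    rw [Real.exp_le_one_iff]
    have h1 : ‖f‖ ^ 2 ≤ 1 := pow_le_one₀ (norm_nonneg _) hf
    have h2 : 0 ≤ θ ^ 2 * s ^ 6 := by positivity
    nlinarith
  refine (lintegral_mono key).trans ?_
  simp

/-- Self-normalised exponential moment of `α² Z²` with `α`, `Z` independent Gaussians, the
first truncated. -/
lemma lintegral_exp_sq_mul_sq_le {e f : E} (he : ‖e‖ = 1) (hf : ‖f‖ ≤ 1) (hef : inner ℝ e f = 0)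
    {θ L : ℝ} (h0 : 0 ≤ θ) (hθ : θ * L ≤ 1 / 40) :
    ∫⁻ x, ENNReal.ofReal (Real.exp (if (inner ℝ e x) ^ 2 ≤ L then
      θ * ((inner ℝ e x) ^ 2 * (inner ℝ f x) ^ 2) - 11 / 10 * (θ * (inner ℝ e x) ^ 2) else 0))
      ∂(stdGaussian E) ≤ ENNReal.ofReal (Real.exp 0) := by
  have hmeas : Measurable fun p : ℝ × ℝ => ENNReal.ofReal (Real.exp (if p.1 ^ 2 ≤ L then
      θ * (p.1 ^ 2 * p.2 ^ 2) - 11 / 10 * (θ * p.1 ^ 2) else 0)) := by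
    refine (Real.measurable_exp.comp (Measurable.ite ?_ (by fun_prop) (by fun_prop))).ennreal_ofReal
    exact measurableSet_le (by fun_prop) (by fun_prop)
  rw [lintegral_inner_pair_stdGaussian he hef
    (F := fun s t => ENNReal.ofReal (Real.exp (if s ^ 2 ≤ L then
      θ * (s ^ 2 * t ^ 2) - 11 / 10 * (θ * s ^ 2) else 0))) hmeas]
  -- With `x = θ s²`, the conditional log-moment is at most `x + 4 x²`, which is below `11/10 x`
  -- exactly when `x ≤ 1/40`; this is where the hypothesis on `θ L` comes from.
  have key : ∀ s : ℝ, ∫⁻ t, ENNReal.ofReal (Real.exp (if s ^ 2 ≤ L then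
      θ * (s ^ 2 * (‖f‖ * t) ^ 2) - 11 / 10 * (θ * s ^ 2) else 0)) ∂(gaussianReal 0 1) ≤ 1 := by
    intro s
    split_ifs with h
    · set x := θ * s ^ 2 with hx
      have hx0 : 0 ≤ x := by positivity
      have hx1 : x ≤ 1 / 40 := (mul_le_mul_of_nonneg_left h h0).trans hθ
      calc _ ≤ ∫⁻ t, ENNReal.ofReal (Real.exp (-(11 / 10 * x))) *
            ENNReal.ofReal (Real.exp (x * t ^ 2)) ∂(gaussianReal 0 1) := by
            refine lintegral_mono fun t => ?_
            rw [← ENNReal.ofReal_mul (Real.exp_pos _).le, ← Real.exp_add]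
            gcongr
            have h1 : ‖f‖ ^ 2 ≤ 1 := pow_le_one₀ (norm_nonneg _) hf
            have h2 : 0 ≤ x * t ^ 2 := by positivity
            have h3 : θ * (s ^ 2 * (‖f‖ * t) ^ 2) = x * t ^ 2 * ‖f‖ ^ 2 := by rw [hx]; ring
            nlinarith
        _ ≤ ENNReal.ofReal (Real.exp (-(11 / 10 * x))) *
            ENNReal.ofReal (Real.exp (x + 4 * x ^ 2)) := by
            rw [lintegral_const_mul _ (by fun_prop)]
            gcongr
            exact lintegral_exp_mul_sq_gaussianReal_le (by rw [abs_of_nonneg hx0]; linarith)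
        _ ≤ 1 := by
            rw [← ENNReal.ofReal_mul (Real.exp_pos _).le, ← Real.exp_add, ← ENNReal.ofReal_one]
            apply ENNReal.ofReal_le_ofReal
            rw [Real.exp_le_one_iff]
            nlinarith
    · simp
  refine (lintegral_mono key).trans ?_
  simp

end Marginals

/-! ### Chernoff bounds and resampling for product measures -/

section Product

variable {E : Type*} [MeasurableSpace E] {μ : Measure E}

lemma lintegral_pi_prod [IsProbabilityMeasure μ] {ι : Type*} [Fintype ι] {f : E → ℝ≥0∞} (hf : Measurable f) :
    ∫⁻ a, ∏ r : ι, f (a r) ∂(Measure.pi fun _ : ι => μ) = (∫⁻ x, f x ∂μ) ^ Fintype.card ι := by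
  have hi : iIndepFun (fun (r : ι) (a : ι → E) => f (a r)) (Measure.pi fun _ : ι => μ) :=
    iIndepFun_pi (X := fun _ => f) fun _ => hf.aemeasurable
  rw [lintegral_prod_eq_prod_lintegral_of_indepFun _ _ hi fun r => by fun_prop]
  have : ∀ r : ι, ∫⁻ a, f (a r) ∂(Measure.pi fun _ : ι => μ) = ∫⁻ x, f x ∂μ := fun r =>
    (measurePreserving_eval (fun _ : ι => μ) r).lintegral_comp hf
  simp [this]

/-- Chernoff's bound. -/
lemma measure_le_exp_of_lintegral_exp_le {φ : E → ℝ} (hφ : Measurable φ) {c : ℝ}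
    (h : ∫⁻ x, ENNReal.ofReal (Real.exp (φ x)) ∂μ ≤ ENNReal.ofReal (Real.exp c)) (t : ℝ) :
    μ {x | c + t ≤ φ x} ≤ ENNReal.ofReal (Real.exp (-t)) := by
  have h1 := meas_ge_le_lintegral_div (μ := μ) (f := fun x => ENNReal.ofReal (Real.exp (φ x)))
    (by fun_prop) (ε := ENNReal.ofReal (Real.exp (c + t)))
    (by simp [Real.exp_pos]) ENNReal.ofReal_ne_top
  calc μ {x | c + t ≤ φ x}
      ≤ μ {x | ENNReal.ofReal (Real.exp (c + t)) ≤ ENNReal.ofReal (Real.exp (φ x))} := by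
        refine measure_mono fun x hx => ?_
        exact ENNReal.ofReal_le_ofReal (Real.exp_le_exp.2 hx)
    _ ≤ _ := h1
    _ ≤ ENNReal.ofReal (Real.exp c) / ENNReal.ofReal (Real.exp (c + t)) := by gcongr
    _ = ENNReal.ofReal (Real.exp (-t)) := by
        rw [← ENNReal.ofReal_div_of_pos (Real.exp_pos _), ← Real.exp_sub]
        ring_nf

/-- Chernoff's bound for sums of i.i.d. variables. -/
lemma pi_measure_sum_le_exp [IsProbabilityMeasure μ] {m : ℕ} {φ : E → ℝ} (hφ : Measurable φ) {c : ℝ}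
    (h : ∫⁻ x, ENNReal.ofReal (Real.exp (φ x)) ∂μ ≤ ENNReal.ofReal (Real.exp c)) (t : ℝ) :
    (Measure.pi fun _ : Fin m => μ) {a | m * c + t ≤ ∑ r, φ (a r)} ≤
      ENNReal.ofReal (Real.exp (-t)) := by
  refine measure_le_exp_of_lintegral_exp_le (by fun_prop) ?_ t
  have : ∀ a : Fin m → E, ENNReal.ofReal (Real.exp (∑ r, φ (a r))) =
      ∏ r, ENNReal.ofReal (Real.exp (φ (a r))) := by
    intro a
    rw [Real.exp_sum, ENNReal.ofReal_prod_of_nonneg fun _ _ => (Real.exp_pos _).le]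
  simp_rw [this]
  rw [lintegral_pi_prod (f := fun x => ENNReal.ofReal (Real.exp (φ x))) (by fun_prop),
    Fintype.card_fin, Real.exp_nat_mul, ENNReal.ofReal_pow (Real.exp_pos _).le]
  gcongr

lemma pi_measure_eval_le_exp [IsProbabilityMeasure μ] {m : ℕ} {φ : E → ℝ} (hφ : Measurable φ) {c : ℝ}
    (h : ∫⁻ x, ENNReal.ofReal (Real.exp (φ x)) ∂μ ≤ ENNReal.ofReal (Real.exp c)) (t : ℝ)
    (s : Fin m) :
    (Measure.pi fun _ : Fin m => μ) {a | c + t ≤ φ (a s)} ≤ ENNReal.ofReal (Real.exp (-t)) := by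
  have := (measurePreserving_eval (fun _ : Fin m => μ) s).measure_preimage
    (s := {x | c + t ≤ φ x}) (measurableSet_le (by fun_prop) (by fun_prop)).nullMeasurableSet
  exact this.trans_le (measure_le_exp_of_lintegral_exp_le hφ h t)

/-- An event that is unlikely when one coordinate is resampled, whatever the others, is
unlikely. -/
lemma pi_measure_le_of_update [IsProbabilityMeasure μ] {ι : Type*} [Fintype ι] [DecidableEq ι] {S : Set (ι → E)}
    (hS : MeasurableSet S) (s : ι) {δ : ℝ≥0∞}
    (h : ∀ a : ι → E, μ {x | Function.update a s x ∈ S} ≤ δ) :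
    (Measure.pi fun _ : ι => μ) S ≤ δ := by
  have hle := lintegral_le_of_lmarginal_le (μ := fun _ : ι => μ) {s}
    (f := S.indicator 1) (g := fun _ => δ) (measurable_one.indicator hS) measurable_const ?_
  · rw [lintegral_indicator_one hS] at hle
    simpa using hle
  · intro a
    simp only [lmarginal_singleton]
    have hm : MeasurableSet {x | Function.update a s x ∈ S} := (measurable_update a) hS
    have : ∀ x, S.indicator (1 : (ι → E) → ℝ≥0∞) (Function.update a s x) =
        {x | Function.update a s x ∈ S}.indicator 1 x := fun x => by
      simp [Set.indicator]
    simp only [this, lintegral_indicator_one hm]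
    simpa using h a

end Product

/-- Exponential moment of the squared norm of a standard Gaussian vector. -/
lemma lintegral_exp_norm_sq_le {n : ℕ} {θ : ℝ} (hθ : |θ| ≤ 1 / 4) :
    ∫⁻ x, ENNReal.ofReal (Real.exp (θ * ‖x‖ ^ 2)) ∂(stdGaussian (EuclideanSpace ℝ (Fin n))) ≤
      ENNReal.ofReal (Real.exp (n * (θ + 4 * θ ^ 2))) := by
  rw [← map_pi_eq_stdGaussian, lintegral_map (by fun_prop) (by fun_prop)]
  have : ∀ x : Fin n → ℝ, ENNReal.ofReal (Real.exp (θ * ‖WithLp.toLp 2 x‖ ^ 2)) =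
      ∏ i, ENNReal.ofReal (Real.exp (θ * x i ^ 2)) := by
    intro x
    rw [EuclideanSpace.real_norm_sq_eq, Finset.mul_sum, Real.exp_sum,
      ENNReal.ofReal_prod_of_nonneg fun _ _ => (Real.exp_pos _).le]
  simp_rw [this]
  rw [lintegral_pi_prod (f := fun t : ℝ => ENNReal.ofReal (Real.exp (θ * t ^ 2))) (by fun_prop),
    Fintype.card_fin, Real.exp_nat_mul, ENNReal.ofReal_pow (Real.exp_pos _).le]
  gcongr
  exact lintegral_exp_mul_sq_gaussianReal_le hθ

/-! ### Nets in the unit ball -/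

section Nets

variable {E : Type*} [NormedAddCommGroup E] [NormedSpace ℝ E] [FiniteDimensional ℝ E]

open Metric Module in
/-- A `1/4`-separated subset of the unit ball has at most `9 ^ dim` elements. -/
lemma card_le_of_quarter_separated (s : Finset E) (hs : ∀ c ∈ s, ‖c‖ ≤ 1)
    (h : ∀ c ∈ s, ∀ d ∈ s, c ≠ d → 1 / 4 ≤ ‖c - d‖) : s.card ≤ 9 ^ finrank ℝ E := by
  borelize E
  let μ : Measure E := Measure.addHaar
  -- Volume comparison: the balls of radius 1/8 are disjoint and lie in a ball of radius 9/8, a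
  -- ratio of 9.
  have hδ : (0 : ℝ) < 1 / 8 := by norm_num
  have hρ : (0 : ℝ) < 9 / 8 := by norm_num
  set A := ⋃ c ∈ s, ball (c : E) (1 / 8) with hA
  have D : (s : Set E).PairwiseDisjoint (fun c => ball (c : E) (1 / 8)) := by
    rintro c hc d hd hcd
    apply ball_disjoint_ball
    rw [dist_eq_norm]
    refine le_trans (by norm_num) (h c hc d hd hcd)
  have A_subset : A ⊆ ball (0 : E) (9 / 8) := by
    refine iUnion₂_subset fun x hx => ball_subset_ball' ?_
    rw [dist_zero_right]
    linarith [hs x hx]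
  have I : (s.card : ℝ≥0∞) * ENNReal.ofReal ((1 / 8 : ℝ) ^ finrank ℝ E) * μ (ball 0 1) ≤
      ENNReal.ofReal ((9 / 8 : ℝ) ^ finrank ℝ E) * μ (ball 0 1) :=
    calc
      _ = μ A := by
        rw [hA, measure_biUnion_finset D fun c _ => measurableSet_ball]
        simp only [μ.addHaar_ball_of_pos _ hδ, Finset.sum_const, nsmul_eq_mul, mul_assoc]
      _ ≤ μ (ball (0 : E) (9 / 8)) := measure_mono A_subset
      _ = _ := μ.addHaar_ball_of_pos _ hρ
  have J := (ENNReal.mul_le_mul_iff_left (measure_ball_pos μ _ zero_lt_one).ne'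
    measure_ball_lt_top.ne).1 I
  have K : (s.card : ℝ) ≤ (9 : ℝ) ^ finrank ℝ E := by
    have := ENNReal.toReal_le_of_le_ofReal (by positivity) J
    rw [ENNReal.toReal_mul, ENNReal.toReal_natCast, ENNReal.toReal_ofReal (by positivity),
      div_pow, div_pow, one_pow] at this
    have h8 : (0 : ℝ) < 8 ^ finrank ℝ E := by positivity
    rw [mul_one_div, div_le_div_iff_of_pos_right h8] at this
    exact this
  exact mod_cast K

open Module in
-- A quarter-separated subset of the unit ball of maximal cardinality is a net, since an uncovered
-- point could be added to it. The volume bound makes the maximum exist.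
lemma exists_quarter_net : ∃ N : Finset E, N.card ≤ 9 ^ finrank ℝ E ∧ (∀ c ∈ N, ‖c‖ ≤ 1) ∧
    ∀ z : E, ‖z‖ ≤ 1 → ∃ c ∈ N, ‖z - c‖ ≤ 1 / 4 := by
  classical
  let P : Finset E → Prop := fun s => (∀ c ∈ s, ‖c‖ ≤ 1) ∧
    ∀ c ∈ s, ∀ d ∈ s, c ≠ d → 1 / 4 ≤ ‖c - d‖
  have hbdd : BddAbove {k | ∃ s, P s ∧ s.card = k} :=
    ⟨9 ^ finrank ℝ E, by
      rintro k ⟨s, hs, rfl⟩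
      exact card_le_of_quarter_separated s hs.1 hs.2⟩
  obtain ⟨N, hN, hcard⟩ := Nat.sSup_mem (s := {k | ∃ s, P s ∧ s.card = k})
    ⟨0, ∅, by simp [P], rfl⟩ hbdd
  refine ⟨N, card_le_of_quarter_separated N hN.1 hN.2, hN.1, fun z hz => ?_⟩
  by_contra! hcon
  have hzN : z ∉ N := fun hz' => by
    have := hcon z hz'
    simp at this
    linarith
  have hP : P (insert z N) := by
    refine ⟨?_, ?_⟩
    · intro c hc
      rcases Finset.mem_insert.1 hc with rfl | hc
      · exact hz
      · exact hN.1 c hc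
    · intro c hc d hd hcd
      rcases Finset.mem_insert.1 hc with rfl | hc' <;> rcases Finset.mem_insert.1 hd with rfl | hd'
      · exact absurd rfl hcd
      · exact (hcon d hd').le
      · rw [norm_sub_rev]
        exact (hcon c hc').le
      · exact hN.2 c hc' d hd' hcd
  have := le_csSup hbdd ⟨insert z N, hP, rfl⟩
  rw [← hcard, Finset.card_insert_of_notMem hzN] at this
  omega

end Nets

lemma norm_apply_le_of_net {E F : Type*} [NormedAddCommGroup E] [NormedSpace ℝ E]
    [NormedAddCommGroup F] [NormedSpace ℝ F] {N : Finset E}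
    (hN : ∀ z : E, ‖z‖ ≤ 1 → ∃ c ∈ N, ‖z - c‖ ≤ 1 / 4) (T : E →L[ℝ] F) {t : ℝ}
    (hT : ∀ c ∈ N, ‖T c‖ ≤ t) (z : E) : ‖T z‖ ≤ 4 / 3 * t * ‖z‖ := by
  have ht : 0 ≤ t := by
    obtain ⟨c, hc, -⟩ := hN 0 (by simp)
    exact (norm_nonneg _).trans (hT c hc)
  have h1 : ‖T‖ ≤ t + ‖T‖ * (1 / 4) := by
    refine T.opNorm_le_of_unit_norm (by positivity) fun x hx => ?_
    obtain ⟨c, hc, hxc⟩ := hN x hx.le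
    calc ‖T x‖ = ‖T c + T (x - c)‖ := by rw [← map_add]; simp
      _ ≤ ‖T c‖ + ‖T (x - c)‖ := norm_add_le _ _
      _ ≤ t + ‖T‖ * (1 / 4) := by
        gcongr
        · exact hT c hc
        · exact (T.le_opNorm _).trans (by gcongr)
  refine (T.le_opNorm z).trans ?_
  gcongr
  linarith


/-! ### The components of the sensing vectors orthogonal to the signal -/

section Perp

variable {E : Type*} [NormedAddCommGroup E] [InnerProductSpace ℝ E]

/-- The component of `x` orthogonal to the unit vector `e`. -/
def perp (e x : E) : E := x - inner ℝ e x • e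

lemma perp_add (e x y : E) : perp e (x + y) = perp e x + perp e y := by
  simp only [perp, inner_add_right, add_smul]; abel

lemma perp_smul (e : E) (c : ℝ) (x : E) : perp e (c • x) = c • perp e x := by
  simp only [perp, inner_smul_right, mul_smul, smul_sub]

lemma inner_perp {e : E} (he : ‖e‖ = 1) (x : E) : inner ℝ e (perp e x) = 0 := by
  simp [perp, inner_sub_right, inner_smul_right, he]

lemma inner_perp_left (e x y : E) : inner ℝ (perp e x) y = inner ℝ x (perp e y) := by
  simp [perp, inner_sub_left, inner_sub_right, inner_smul_left, inner_smul_right,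
    real_inner_comm e x, mul_comm]

lemma norm_sq_eq_add_norm_perp_sq {e : E} (he : ‖e‖ = 1) (x : E) :
    ‖x‖ ^ 2 = (inner ℝ e x) ^ 2 + ‖perp e x‖ ^ 2 := by
  have h : ‖perp e x‖ ^ 2 = ‖x‖ ^ 2 - 2 * (inner ℝ e x * inner ℝ e x) + (inner ℝ e x) ^ 2 := by
    rw [perp, norm_sub_sq_real, inner_smul_right, norm_smul, he, real_inner_comm]
    simp
  rw [h]; ring

lemma norm_perp_le {e : E} (he : ‖e‖ = 1) (x : E) : ‖perp e x‖ ≤ ‖x‖ := by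
  have := norm_sq_eq_add_norm_perp_sq he x
  exact le_of_sq_le_sq (by nlinarith [sq_nonneg (inner ℝ e x : ℝ)]) (norm_nonneg _)

@[fun_prop]
lemma continuous_perp (e : E) : Continuous (perp e) := by
  unfold perp
  fun_prop

variable {m : ℕ}

/-- The block of the spectral matrix acting on the complement of `e`, restricted to the
measurements in `J`. -/
def perpOp (e : E) (a : Fin m → E) (J : Finset (Fin m)) (z : E) : E :=
  (1 / (m : ℝ)) • ∑ r ∈ J, ((inner ℝ e (a r)) ^ 2 * inner ℝ (perp e (a r)) z) • perp e (a r)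

/-- The off-diagonal block of the spectral matrix, restricted to the measurements in `J`. -/
def perpVec (e : E) (a : Fin m → E) (J : Finset (Fin m)) : E :=
  (1 / (m : ℝ)) • ∑ r ∈ J, (inner ℝ e (a r)) ^ 3 • perp e (a r)

lemma perpOp_add (e : E) (a : Fin m → E) (J : Finset (Fin m)) (x y : E) :
    perpOp e a J (x + y) = perpOp e a J x + perpOp e a J y := by
  simp only [perpOp, inner_add_right, mul_add, add_smul, Finset.sum_add_distrib, smul_add]

lemma perpOp_smul (e : E) (a : Fin m → E) (J : Finset (Fin m)) (c : ℝ) (x : E) :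
    perpOp e a J (c • x) = c • perpOp e a J x := by
  simp only [perpOp, inner_smul_right, Finset.smul_sum, smul_smul]
  refine Finset.sum_congr rfl fun r _ => ?_
  congr 1
  ring

lemma inner_perpOp (e : E) (a : Fin m → E) (J : Finset (Fin m)) (x y : E) :
    inner ℝ (perpOp e a J x) y = 1 / (m : ℝ) * ∑ r ∈ J, (inner ℝ e (a r)) ^ 2 *
      (inner ℝ (perp e (a r)) x * inner ℝ (perp e (a r)) y) := by
  rw [perpOp, real_inner_smul_left, sum_inner]
  congr 1
  refine Finset.sum_congr rfl fun r _ => ?_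
  rw [real_inner_smul_left, mul_assoc]

/-- A bound for the quadratic form bounds the operator, also after removing measurements. -/
lemma norm_perpOp_le {e : E} {a : Fin m → E} {B : ℝ} (hB : 0 ≤ B)
    (h : ∀ z, ∑ r, (inner ℝ e (a r)) ^ 2 * (inner ℝ (perp e (a r)) z) ^ 2 ≤ B * m * ‖z‖ ^ 2)
    (J : Finset (Fin m)) (z : E) : ‖perpOp e a J z‖ ≤ B * ‖z‖ := by
  rcases Nat.eq_zero_or_pos m with rfl | hm
  · simp [perpOp]; positivity
  have hm' : (0 : ℝ) < m := by exact_mod_cast hm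
  set y := perpOp e a J z with hy
  -- Dropping measurements only lowers a sum of squares, so the leave-one-out blocks inherit the
  -- bound without a probabilistic estimate of their own. Cauchy–Schwarz then passes from the form
  -- to the operator.
  have hJ : ∀ z, ∑ r ∈ J, (inner ℝ e (a r) * inner ℝ (perp e (a r)) z) ^ 2 ≤
      B * m * ‖z‖ ^ 2 := fun z => by
    refine le_trans (Finset.sum_le_univ_sum_of_nonneg fun r => sq_nonneg _) ?_
    simpa only [mul_pow] using h z
  have h1 : ‖y‖ ^ 2 = 1 / (m : ℝ) * ∑ r ∈ J, (inner ℝ e (a r) * inner ℝ (perp e (a r)) z) *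
      (inner ℝ e (a r) * inner ℝ (perp e (a r)) y) := by
    rw [← real_inner_self_eq_norm_sq]
    conv_lhs => rw [hy, inner_perpOp, ← hy]
    congr 1
    refine Finset.sum_congr rfl fun r _ => ?_
    ring
  have h2 := Finset.sum_mul_sq_le_sq_mul_sq J (fun r => inner ℝ e (a r) * inner ℝ (perp e (a r)) z)
    (fun r => inner ℝ e (a r) * inner ℝ (perp e (a r)) y)
  have h3 : (‖y‖ ^ 2) ^ 2 ≤ (B * ‖z‖ * ‖y‖) ^ 2 := by
    have hS : (∑ r ∈ J, (inner ℝ e (a r) * inner ℝ (perp e (a r)) z) *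
      (inner ℝ e (a r) * inner ℝ (perp e (a r)) y)) = m * ‖y‖ ^ 2 := by
      rw [h1]; field_simp
    rw [hS] at h2
    have h4 := h2.trans (mul_le_mul (hJ z) (hJ y) (Finset.sum_nonneg fun _ _ => sq_nonneg _)
      (by positivity))
    have h5 : (m : ℝ) ^ 2 * (‖y‖ ^ 2) ^ 2 ≤ (m : ℝ) ^ 2 * (B * ‖z‖ * ‖y‖) ^ 2 := by
      calc _ = (m * ‖y‖ ^ 2) ^ 2 := by ring
        _ ≤ _ := h4
        _ = _ := by ring
    exact le_of_mul_le_mul_left h5 (by positivity)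
  have h6 := le_of_sq_le_sq h3 (by positivity)
  rcases (norm_nonneg y).eq_or_lt with h0 | h0
  · rw [← h0]; positivity
  · exact le_of_mul_le_mul_right (by rw [← sq]; exact h6) h0

end Perp

/-! ### A truncated Neumann series -/

section Neumann

variable {E : Type*} {f : E → E}

lemma iterate_add_of_additive [AddCommGroup E] (hadd : ∀ x y, f (x + y) = f x + f y) (k : ℕ) (x y : E) :
    f^[k] (x + y) = f^[k] x + f^[k] y := by
  induction k generalizing x y with
  | zero => rfl
  | succ k ih => simp only [Function.iterate_succ_apply, hadd, ih]

lemma iterate_smul_of_homogeneous [AddCommGroup E] [Module ℝ E] (hsmul : ∀ (c : ℝ) x, f (c • x) = c • f x) (k : ℕ) (c : ℝ)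
    (x : E) : f^[k] (c • x) = c • f^[k] x := by
  induction k generalizing x with
  | zero => rfl
  | succ k ih => simp only [Function.iterate_succ_apply, hsmul, ih]

lemma norm_iterate_le [NormedAddCommGroup E] {B : ℝ} (hB : 0 ≤ B) (h : ∀ x, ‖f x‖ ≤ B * ‖x‖) (k : ℕ) (x : E) :
    ‖f^[k] x‖ ≤ B ^ k * ‖x‖ := by
  induction k with
  | zero => simp
  | succ k ih =>
    rw [Function.iterate_succ_apply', pow_succ', mul_assoc]
    exact (h _).trans (mul_le_mul_of_nonneg_left ih hB)

/-- If `μ v = f v + z` with `‖f‖ ≤ 9 / 4 < 11 / 4 ≤ μ`, the component of `v` along `b` is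
controlled by the components of the iterates `f^k z`. -/
lemma abs_inner_le_of_resolvent [NormedAddCommGroup E] [InnerProductSpace ℝ E]
    (hadd : ∀ x y, f (x + y) = f x + f y)
    (hsmul : ∀ (c : ℝ) x, f (c • x) = c • f x) (hf : ∀ x, ‖f x‖ ≤ 9 / 4 * ‖x‖)
    {μ : ℝ} (hμ : 11 / 4 ≤ μ) {v z b : E} (hv : μ • v = f v + z) {D : ℝ} (K : ℕ)
    (hD : ∀ k < K, |inner ℝ b (f^[k] z)| ≤ D * (9 / 4) ^ k) (hD0 : 0 ≤ D) :
    |inner ℝ b v| ≤ 2 * D + ‖b‖ * (9 / 11) ^ K * ‖v‖ := by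
  have hμ0 : 0 < μ := by linarith
  have hv' : v = μ⁻¹ • z + μ⁻¹ • f v := by
    rw [← smul_add, add_comm z, ← hv, smul_smul, inv_mul_cancel₀ hμ0.ne', one_smul]
  have step : ∀ k, f^[k] v = μ⁻¹ • f^[k] z + μ⁻¹ • f^[k + 1] v := fun k => by
    conv_lhs => rw [hv', iterate_add_of_additive hadd, iterate_smul_of_homogeneous hsmul,
      iterate_smul_of_homogeneous hsmul, ← Function.iterate_succ_apply]
  have hinv : μ⁻¹ ≤ 4 / 11 := by
    rw [inv_le_comm₀ hμ0 (by norm_num)]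
    norm_num
    linarith
  have hinv0 : 0 < μ⁻¹ := inv_pos.2 hμ0
  -- Step `k` costs `4/11 · D · (9/11)^k`; the geometric sum of these costs is `2 D (1 - (9/11)^k)`.
  have main : ∀ k ≤ K, |inner ℝ b v| ≤ 2 * D * (1 - (9 / 11) ^ k) +
      (4 / 11) ^ k * |inner ℝ b (f^[k] v)| := by
    intro k hk
    induction k with
    | zero => simp
    | succ k ih =>
      refine (ih (by omega)).trans ?_
      have h1 : |inner ℝ b (f^[k] v)| ≤ 4 / 11 * (D * (9 / 4) ^ k) +
          4 / 11 * |inner ℝ b (f^[k + 1] v)| := by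
        rw [step k, inner_add_right, inner_smul_right, inner_smul_right]
        refine (abs_add_le _ _).trans ?_
        rw [abs_mul, abs_mul, abs_of_pos hinv0]
        gcongr
        exact hD k (by omega)
      have h2 : (4 / 11 : ℝ) ^ k * (4 / 11 * (D * (9 / 4) ^ k)) = 4 / 11 * D * (9 / 11) ^ k := by
        rw [show (9 / 11 : ℝ) = 4 / 11 * (9 / 4) by norm_num, mul_pow]; ring
      calc 2 * D * (1 - (9 / 11) ^ k) + (4 / 11) ^ k * |inner ℝ b (f^[k] v)|
          ≤ 2 * D * (1 - (9 / 11) ^ k) + (4 / 11) ^ k * (4 / 11 * (D * (9 / 4) ^ k) +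
            4 / 11 * |inner ℝ b (f^[k + 1] v)|) := by gcongr
        _ = _ := by rw [mul_add, h2, pow_succ, pow_succ]; ring
  refine (main K le_rfl).trans ?_
  have h3 : |inner ℝ b (f^[K] v)| ≤ ‖b‖ * ((9 / 4) ^ K * ‖v‖) :=
    (abs_real_inner_le_norm _ _).trans
      (mul_le_mul_of_nonneg_left (norm_iterate_le (by norm_num) hf K v) (norm_nonneg _))
  have h4 : (4 / 11 : ℝ) ^ K * (‖b‖ * ((9 / 4) ^ K * ‖v‖)) = ‖b‖ * (9 / 11) ^ K * ‖v‖ := by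
    rw [show (9 / 11 : ℝ) = 4 / 11 * (9 / 4) by norm_num, mul_pow]; ring
  have h5 : (4 / 11 : ℝ) ^ K * |inner ℝ b (f^[K] v)| ≤ ‖b‖ * (9 / 11) ^ K * ‖v‖ := by
    rw [← h4]; gcongr
  have h6 : 0 ≤ D * (9 / 11 : ℝ) ^ K := by positivity
  nlinarith

end Neumann

/-! ### The favourable event and its deterministic consequences -/

/-- The favourable configurations of sensing vectors: empirical moments along `e`, sizes, the
blocks of the spectral matrix, and the leave-one-out bounds. -/
structure IsGood {n m : ℕ} (e : EuclideanSpace ℝ (Fin n)) (a : Fin m → EuclideanSpace ℝ (Fin n))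
    (ε L H W : ℝ) : Prop where
  fourth : 11 / 4 * (m : ℝ) ≤ ∑ r, (inner ℝ e (a r)) ^ 4
  sq_le : ∀ s, (inner ℝ e (a s)) ^ 2 ≤ L
  sixth : ∑ r, (inner ℝ e (a r)) ^ 6 ≤ 2000 * (m : ℝ)
  second : |∑ r, (inner ℝ e (a r)) ^ 2 - m| ≤ ε * m
  norms : |∑ r, ‖a r‖ ^ 2 - n * m| ≤ ε * (n * m)
  norm_le : ∀ s, ‖a s‖ ^ 2 ≤ H
  op : ∀ z, ∑ r, (inner ℝ e (a r)) ^ 2 * (inner ℝ (perp e (a r)) z) ^ 2 ≤ 9 / 4 * m * ‖z‖ ^ 2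
  vec : ‖perpVec e a Finset.univ‖ ≤ W
  leaveOneOut : ∀ s, ∀ k < m, (inner ℝ (perp e (a s)) ((perpOp e a (Finset.univ.erase s))^[k]
    (perpVec e a (Finset.univ.erase s)))) ^ 2 ≤
      L * ‖(perpOp e a (Finset.univ.erase s))^[k] (perpVec e a (Finset.univ.erase s))‖ ^ 2

section Deterministic

variable {n m : ℕ} {e u : EuclideanSpace ℝ (Fin n)} {a : Fin m → EuclideanSpace ℝ (Fin n)}
  {ε L H W μ : ℝ}

lemma inner_eq_perp (e x u : EuclideanSpace ℝ (Fin n)) :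
    inner ℝ x u = inner ℝ e u * inner ℝ e x + inner ℝ (perp e x) u := by
  simp only [perp, inner_sub_left, real_inner_smul_left]
  ring

lemma inner_perp_perp {e : EuclideanSpace ℝ (Fin n)} (he : ‖e‖ = 1)
    (x u : EuclideanSpace ℝ (Fin n)) :
    inner ℝ (perp e x) (perp e u) = inner ℝ (perp e x) u := by
  have h := inner_perp he x
  rw [real_inner_comm] at h
  conv_lhs => rw [perp.eq_def e u]
  rw [inner_sub_right, inner_smul_right, h]
  simp

/-- The eigenvector equation projected onto the complement of `e`, after splitting each `⟨a_r, u⟩`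
along `e` and its complement. -/
lemma perp_eigen (he : ‖e‖ = 1)
    (hu : μ • u = (1 / (m : ℝ)) • ∑ r, ((inner ℝ e (a r)) ^ 2 * inner ℝ (a r) u) • a r) :
    μ • perp e u = perpOp e a Finset.univ (perp e u) +
      inner ℝ e u • perpVec e a Finset.univ := by
  have hperp_sum : ∀ (c : Fin m → ℝ), perp e (∑ r, c r • a r) = ∑ r, c r • perp e (a r) := by
    intro c
    let P : EuclideanSpace ℝ (Fin n) →+ EuclideanSpace ℝ (Fin n) :=
      ⟨⟨perp e, by simp [perp]⟩, perp_add e⟩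
    have := map_sum P (fun r => c r • a r) Finset.univ
    refine this.trans (Finset.sum_congr rfl fun r _ => perp_smul e _ _)
  rw [← perp_smul, hu, perp_smul, hperp_sum, perpOp, perpVec, smul_comm (inner ℝ e u), ← smul_add,
    Finset.smul_sum (r := inner ℝ e u), ← Finset.sum_add_distrib]
  congr 1
  refine Finset.sum_congr rfl fun r _ => ?_
  rw [smul_smul, ← add_smul, inner_perp_perp he, inner_eq_perp e (a r) u]
  congr 1
  ring

lemma perpOp_univ_eq (s : Fin m) (z : EuclideanSpace ℝ (Fin n)) :
    perpOp e a Finset.univ z = perpOp e a (Finset.univ.erase s) z +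
      (1 / (m : ℝ) * ((inner ℝ e (a s)) ^ 2 * inner ℝ (perp e (a s)) z)) • perp e (a s) := by
  rw [perpOp, perpOp, ← Finset.sum_erase_add _ _ (Finset.mem_univ s), smul_add, smul_smul]

lemma perpVec_univ_eq (s : Fin m) :
    perpVec e a Finset.univ = perpVec e a (Finset.univ.erase s) +
      (1 / (m : ℝ) * (inner ℝ e (a s)) ^ 3) • perp e (a s) := by
  rw [perpVec, perpVec, ← Finset.sum_erase_add _ _ (Finset.mem_univ s), smul_add, smul_smul]

lemma abs_inner_unit_le (he : ‖e‖ = 1) (hu1 : ‖u‖ = 1) : |inner ℝ e u| ≤ 1 := by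
  simpa [he, hu1] using abs_real_inner_le_norm e u

/-- The gap `μ - 9/4 ≥ 1/2` makes the lower block absorbable; the off-diagonal block is then the
only source. -/
lemma IsGood.norm_perp_eigenvector_le (hG : IsGood e a ε L H W) (he : ‖e‖ = 1) (hu1 : ‖u‖ = 1)
    (hμ : 11 / 4 ≤ μ)
    (hu : μ • u = (1 / (m : ℝ)) • ∑ r, ((inner ℝ e (a r)) ^ 2 * inner ℝ (a r) u) • a r) :
    ‖perp e u‖ ≤ 2 * W := by
  have h := perp_eigen he hu
  have h1 : μ * ‖perp e u‖ ≤ 9 / 4 * ‖perp e u‖ + W := by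
    calc μ * ‖perp e u‖ = ‖μ • perp e u‖ := by
          rw [norm_smul, Real.norm_of_nonneg (by linarith)]
      _ ≤ ‖perpOp e a Finset.univ (perp e u)‖ + ‖inner ℝ e u • perpVec e a Finset.univ‖ := by
          rw [h]; exact norm_add_le _ _
      _ ≤ _ := by
          gcongr
          · exact norm_perpOp_le (by norm_num) hG.op _ _
          · rw [norm_smul]
            exact (mul_le_of_le_one_left (norm_nonneg _) (abs_inner_unit_le he hu1)).trans hG.vec
  nlinarith [norm_nonneg (perp e u)]

/-- Closes a self-referential estimate: measurement `s` reappears in the bound for its own product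
`p`, but with a factor small enough to be absorbed on the left. -/
lemma le_of_leaveOneOut_bounds {g x p : ℝ} (hg0 : 0 ≤ g) (hg : g ≤ 1 / 4) (hx : 0 ≤ x) (hp : 0 ≤ p)
    (h : p ≤ 2 * (g + x * g + g ^ 2 * (x + p)) + 2 * g) : p ≤ 5 * g * (1 + x) := by
  have h1 : g ^ 2 ≤ g / 4 := by nlinarith
  have h2 : g ^ 2 ≤ 1 / 16 := by nlinarith
  have h3 : g ^ 2 * x ≤ g / 4 * x := mul_le_mul_of_nonneg_right h1 hx
  have h4 : g ^ 2 * p ≤ 1 / 16 * p := mul_le_mul_of_nonneg_right h2 hp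
  have h5 : 0 ≤ g * x := mul_nonneg hg0 hx
  linarith

/-- The leave-one-out estimate: the error of a top eigenvector is nearly orthogonal to every
sensing vector. -/
lemma IsGood.abs_inner_perp_le (hG : IsGood e a ε L H W) (he : ‖e‖ = 1) (hu1 : ‖u‖ = 1)
    (hμ : 11 / 4 ≤ μ)
    (hu : μ • u = (1 / (m : ℝ)) • ∑ r, ((inner ℝ e (a r)) ^ 2 * inner ℝ (a r) u) • a r)
    {g : ℝ} (hL1 : 1 ≤ L) (hLm : L ^ 2 ≤ m) (hW : √L * W ≤ g) (hβ : L * H / m ≤ g ^ 2)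
    (hg : g ≤ 1 / 4) (hH : √H * (9 / 11) ^ m ≤ 1) (s : Fin m) :
    |inner ℝ (perp e (a s)) u| ≤ 5 * g * (1 + |inner ℝ e (a s)|) := by
  have hm : (0 : ℝ) < m := by nlinarith
  have hW0 : 0 ≤ W := (norm_nonneg _).trans hG.vec
  have hH0 : 0 ≤ H := (sq_nonneg _).trans (hG.norm_le s)
  have hsL : 1 ≤ √L := Real.one_le_sqrt.2 hL1
  have hg0 : 0 ≤ g := le_trans (by positivity) hW
  set α := inner ℝ e (a s) with hα
  set b := perp e (a s) with hb
  set c := inner ℝ e u with hc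
  set v := perp e u with hv
  set p := inner ℝ b u with hp
  have hpv : inner ℝ b v = p := inner_perp_perp he _ _
  have hc1 : |c| ≤ 1 := abs_inner_unit_le he hu1
  have hv2 : ‖v‖ ≤ 2 * W := hG.norm_perp_eigenvector_le he hu1 hμ hu
  set f := perpOp e a (Finset.univ.erase s) with hf
  set w := perpVec e a (Finset.univ.erase s) with hw
  -- Removing measurement `s` from both blocks leaves a source term along `b`; `κ` is its
  -- coefficient, and it contains the unknown `p`.
  set κ := 1 / (m : ℝ) * (α ^ 2 * p) + c * (1 / (m : ℝ) * α ^ 3) with hκ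
  have hfn : ∀ x, ‖f x‖ ≤ 9 / 4 * ‖x‖ := norm_perpOp_le (by norm_num) hG.op _
  have heig : μ • v = f v + (c • w + κ • b) := by
    rw [perp_eigen he hu, perpOp_univ_eq s, perpVec_univ_eq s]
    rw [← hα, ← hb, ← hc, ← hv, ← hf, ← hw, hpv, smul_add, smul_smul, hκ, add_smul]
    abel
  have hbH : ‖b‖ ≤ √H := Real.le_sqrt_of_sq_le
    ((pow_le_pow_left₀ (norm_nonneg _) (norm_perp_le he _) 2).trans (hG.norm_le s))
  have hbH2 : ‖b‖ ^ 2 ≤ H :=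
    (pow_le_pow_left₀ (norm_nonneg _) (norm_perp_le he _) 2).trans (hG.norm_le s)
  have hα2 : |α| ^ 2 ≤ L := by rw [sq_abs]; exact hG.sq_le s
  -- The first summand uses independence, which replaces `‖b‖` by `√L`. The second is plain
  -- Cauchy–Schwarz, affordable because `κ` carries the factor `1/m` and `L H / m ≤ g²`.
  set D := √L * ‖w‖ + |κ| * ‖b‖ ^ 2 with hD
  -- Truncating after `m` steps makes the remainder negligible, since `√H (9/11)^m ≤ 1`, and keeps
  -- the number of leave-one-out events polynomial in `m`.
  have hfin := abs_inner_le_of_resolvent (f := f) (b := b) (D := D) (perpOp_add e a _)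
    (perpOp_smul e a _) hfn hμ heig m ?_ (by positivity)
  · rw [hpv] at hfin
    have hwn : ‖w‖ ≤ W + |α| ^ 3 * √H / m := by
      have h1 : w = perpVec e a Finset.univ - (1 / (m : ℝ) * α ^ 3) • b := by
        rw [perpVec_univ_eq s]; abel
      rw [h1]
      refine (norm_sub_le _ _).trans (add_le_add hG.vec ?_)
      rw [norm_smul, Real.norm_eq_abs, abs_mul, abs_of_pos (by positivity), abs_pow]
      calc 1 / (m : ℝ) * |α| ^ 3 * ‖b‖ ≤ 1 / (m : ℝ) * |α| ^ 3 * √H := by gcongr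
        _ = _ := by ring
    have hβs : √(L * H / m) ≤ g := Real.sqrt_le_iff.2 ⟨hg0, hβ⟩
    have h2 : √L * (|α| ^ 3 * √H / m) ≤ |α| * g := by
      have hLsm : L ≤ √m := Real.le_sqrt_of_sq_le hLm
      have hsm : 0 < √(m : ℝ) := Real.sqrt_pos.2 hm
      have h3 : √(L * H / m) = √L * √H / √m := by
        rw [Real.sqrt_div' _ hm.le, Real.sqrt_mul (by linarith)]
      calc √L * (|α| ^ 3 * √H / m) = |α| * (√L * √H / m) * |α| ^ 2 := by ring
        _ ≤ |α| * (√L * √H / m) * √m := by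
            gcongr
            exact hα2.trans hLsm
        _ = |α| * √(L * H / m) := by
            rw [h3]
            nth_rewrite 1 [← Real.mul_self_sqrt hm.le]
            field_simp
        _ ≤ |α| * g := by gcongr
    have h4 : √L * ‖w‖ ≤ g + |α| * g := by
      calc √L * ‖w‖ ≤ √L * (W + |α| ^ 3 * √H / m) := by gcongr
        _ = √L * W + √L * (|α| ^ 3 * √H / m) := by ring
        _ ≤ _ := add_le_add hW h2
    have h5 : |κ| * ‖b‖ ^ 2 ≤ g ^ 2 * (|α| + |p|) := by
      have h6 : |κ| ≤ 1 / (m : ℝ) * |α| ^ 2 * (|α| + |p|) := by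
        rw [hκ]
        refine (abs_add_le _ _).trans ?_
        rw [abs_mul, abs_mul, abs_mul, abs_mul, abs_of_pos (show (0 : ℝ) < 1 / m by positivity),
          abs_pow, abs_pow]
        have h6' : |c| * (1 / (m : ℝ) * |α| ^ 3) ≤ 1 * (1 / (m : ℝ) * |α| ^ 3) := by gcongr
        refine (add_le_add_right h6' _).trans (le_of_eq ?_)
        ring
      calc |κ| * ‖b‖ ^ 2 ≤ 1 / (m : ℝ) * |α| ^ 2 * (|α| + |p|) * ‖b‖ ^ 2 := by gcongr
        _ ≤ 1 / (m : ℝ) * L * (|α| + |p|) * H := by gcongr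
        _ = L * H / m * (|α| + |p|) := by ring
        _ ≤ _ := by gcongr
    have h7 : ‖b‖ * (9 / 11) ^ m * ‖v‖ ≤ 2 * g := by
      calc ‖b‖ * (9 / 11) ^ m * ‖v‖ ≤ √H * (9 / 11) ^ m * (2 * W) := by gcongr
        _ ≤ 1 * (2 * W) := by gcongr
        _ ≤ 2 * (√L * W) := by
          rw [one_mul]
          exact mul_le_mul_of_nonneg_left (le_mul_of_one_le_left hW0 hsL) zero_le_two
        _ ≤ 2 * g := by linarith
    exact le_of_leaveOneOut_bounds hg0 hg (abs_nonneg α) (abs_nonneg p)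
      (hfin.trans (add_le_add (mul_le_mul_of_nonneg_left (add_le_add h4 h5) zero_le_two) h7))
  · intro k hk
    rw [iterate_add_of_additive (perpOp_add e a _), iterate_smul_of_homogeneous (perpOp_smul e a _),
      iterate_smul_of_homogeneous (perpOp_smul e a _), inner_add_right, inner_smul_right,
      inner_smul_right]
    refine (abs_add_le _ _).trans ?_
    rw [abs_mul, abs_mul, hD, add_mul]
    refine add_le_add ?_ ?_
    · have h1 : |inner ℝ b (f^[k] w)| ≤ √L * ‖f^[k] w‖ := by
        refine abs_le_of_sq_le_sq ?_ (by positivity)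
        rw [mul_pow, Real.sq_sqrt (by linarith)]
        exact hG.leaveOneOut s k hk
      calc |c| * |inner ℝ b (f^[k] w)| ≤ 1 * (√L * ‖f^[k] w‖) := by gcongr
        _ ≤ 1 * (√L * ((9 / 4) ^ k * ‖w‖)) := by
            gcongr
            exact norm_iterate_le (by norm_num) hfn k w
        _ = _ := by ring
    · have h1 : |inner ℝ b (f^[k] b)| ≤ ‖b‖ * ((9 / 4) ^ k * ‖b‖) :=
        (abs_real_inner_le_norm _ _).trans
          (mul_le_mul_of_nonneg_left (norm_iterate_le (by norm_num) hfn k b) (norm_nonneg _))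
      calc |κ| * |inner ℝ b (f^[k] b)| ≤ |κ| * (‖b‖ * ((9 / 4) ^ k * ‖b‖)) := by gcongr
        _ = _ := by ring

end Deterministic

/-! ### The spectral initialiser on the favourable event -/

section Spectral

variable {n m : ℕ}

lemma spectralMatrix_apply (a : Fin m → EuclideanSpace ℝ (Fin n)) (y : Fin m → ℝ)
    (z : EuclideanSpace ℝ (Fin n)) :
    spectralMatrix a y z = (1 / (m : ℝ)) • ∑ r, (y r * inner ℝ (a r) z) • a r := by
  simp [spectralMatrix, InnerProductSpace.rankOne_apply, smul_smul]

lemma inner_spectralMatrix (a : Fin m → EuclideanSpace ℝ (Fin n)) (y : Fin m → ℝ)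
    (x z : EuclideanSpace ℝ (Fin n)) :
    inner ℝ (spectralMatrix a y x) z =
      1 / (m : ℝ) * ∑ r, y r * (inner ℝ (a r) x * inner ℝ (a r) z) := by
  rw [spectralMatrix_apply, real_inner_smul_left, sum_inner]
  congr 1
  refine Finset.sum_congr rfl fun r _ => ?_
  rw [real_inner_smul_left, mul_assoc]

/-- The largest eigenvalue of a symmetric operator dominates its quadratic form on unit vectors. -/
lemma inner_le_of_forall_eigenvalue_le {T : EuclideanSpace ℝ (Fin n) →L[ℝ] EuclideanSpace ℝ (Fin n)}
    (hT : (T : Module.End ℝ (EuclideanSpace ℝ (Fin n))).IsSymmetric) {μ : ℝ}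
    (hμ : ∀ ν : ℝ, Module.End.HasEigenvalue (T : Module.End ℝ (EuclideanSpace ℝ (Fin n))) ν → ν ≤ μ)
    {e : EuclideanSpace ℝ (Fin n)} (he : ‖e‖ = 1) : inner ℝ (T e) e ≤ μ := by
  have he0 : e ≠ 0 := by
    rintro rfl
    simp at he
  have : Nontrivial (EuclideanSpace ℝ (Fin n)) := ⟨e, 0, he0⟩
  refine le_trans ?_ (hμ _ hT.hasEigenvalue_iSup_of_finiteDimensional)
  have hb : BddAbove (Set.range fun x : {x : EuclideanSpace ℝ (Fin n) // x ≠ 0} =>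
      RCLike.re (inner ℝ ((T : Module.End ℝ (EuclideanSpace ℝ (Fin n))) x) (x : EuclideanSpace ℝ (Fin n))) /
        ‖(x : EuclideanSpace ℝ (Fin n))‖ ^ 2) := by
    refine ⟨‖T‖, ?_⟩
    rintro _ ⟨x, rfl⟩
    have hx : 0 < ‖(x : EuclideanSpace ℝ (Fin n))‖ ^ 2 := by
      have := norm_pos_iff.2 x.2
      positivity
    simp only [ContinuousLinearMap.coe_coe, RCLike.re_to_real]
    rw [div_le_iff₀ hx]
    calc inner ℝ (T x) (x : EuclideanSpace ℝ (Fin n)) ≤ ‖T x‖ * ‖(x : EuclideanSpace ℝ (Fin n))‖ :=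
          real_inner_le_norm _ _
      _ ≤ ‖T‖ * ‖(x : EuclideanSpace ℝ (Fin n))‖ * ‖(x : EuclideanSpace ℝ (Fin n))‖ := by
          gcongr
          exact T.le_opNorm _
      _ = _ := by ring
  refine le_trans (le_of_eq ?_) (le_ciSup hb ⟨e, he0⟩)
  simp [he]

lemma abs_sqrt_sub_one_le {x : ℝ} (hx : 0 ≤ x) : |√x - 1| ≤ |x - 1| := by
  have h : x - 1 = (√x - 1) * (√x + 1) := by
    nth_rewrite 1 [← Real.mul_self_sqrt hx]
    ring
  rw [h, abs_mul]
  refine le_mul_of_one_le_right (abs_nonneg _) ?_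
  rw [abs_of_nonneg (by positivity)]
  linarith [Real.sqrt_nonneg x]

lemma abs_div_sub_one_le {A S ε : ℝ} (hA : |A - 1| ≤ ε) (hS : |S - 1| ≤ ε) (hε : ε ≤ 1 / 4) :
    |A / S - 1| ≤ 3 * ε := by
  obtain ⟨h1, h2⟩ := abs_le.1 hA
  obtain ⟨h3, h4⟩ := abs_le.1 hS
  have hS0 : 0 < S := by linarith
  have hε0 : 0 ≤ ε := (abs_nonneg _).trans hA
  rw [abs_le]
  constructor
  · have : 1 - 3 * ε ≤ A / S := by
      rw [le_div_iff₀ hS0]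
      nlinarith
    linarith
  · rw [sub_le_iff_le_add, div_le_iff₀ hS0]
    nlinarith

variable {e : EuclideanSpace ℝ (Fin n)} {a : Fin m → EuclideanSpace ℝ (Fin n)} {ε L H W : ℝ}

lemma measurements_smul (R : ℝ) (r : Fin m) :
    measurements a (R • e) r = R ^ 2 * (inner ℝ e (a r)) ^ 2 := by
  rw [measurements, inner_smul_right, real_inner_comm, mul_pow]

lemma IsGood.spectralScale_eq (hG : IsGood e a ε L H W) {R : ℝ} (hR : 0 < R) (hε : ε ≤ 1 / 4)
    (hn : 0 < n) (hm : 0 < m) :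
    ∃ s, spectralScale a (measurements a (R • e)) = R * s ∧ |s - 1| ≤ 3 * ε := by
  have hn' : (0 : ℝ) < n := by exact_mod_cast hn
  have hm' : (0 : ℝ) < m := by exact_mod_cast hm
  set A := (∑ r, (inner ℝ e (a r)) ^ 2) / (m : ℝ) with hA
  set S := (∑ r, ‖a r‖ ^ 2) / (n * m : ℝ) with hS
  have hA1 : |A - 1| ≤ ε := by
    have : A - 1 = (∑ r, (inner ℝ e (a r)) ^ 2 - m) / m := by rw [hA]; field_simp
    rw [this, abs_div, abs_of_pos hm', div_le_iff₀ hm']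
    exact hG.second
  have hS1 : |S - 1| ≤ ε := by
    have : S - 1 = (∑ r, ‖a r‖ ^ 2 - n * m) / (n * m) := by rw [hS]; field_simp
    rw [this, abs_div, abs_of_pos (show (0 : ℝ) < n * m by positivity),
      div_le_iff₀ (by positivity)]
    exact hG.norms
  refine ⟨√(A / S), ?_, (abs_sqrt_sub_one_le (by positivity)).trans
    (abs_div_sub_one_le hA1 hS1 hε)⟩
  have hS0 : 0 < S := by linarith [(abs_le.1 hS1).1]
  have hsum : 0 < ∑ r, ‖a r‖ ^ 2 := by
    rw [hS] at hS0
    exact (div_pos_iff_of_pos_right (by positivity)).1 hS0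
  rw [spectralScale]
  simp_rw [measurements_smul]
  rw [← Finset.mul_sum, ← Real.sqrt_sq hR.le, ← Real.sqrt_mul (sq_nonneg _), Real.sqrt_sq hR.le]
  congr 1
  rw [hA, hS]
  field_simp

/-- An eigenvector equation for the spectral matrix of the normalised signal. -/
lemma IsGood.exists_eigenvalue (hG : IsGood e a ε L H W) (he : ‖e‖ = 1) {R : ℝ} (hR : 0 < R)
    (hm : 0 < m) {u : EuclideanSpace ℝ (Fin n)}
    (hu : IsTopEigenvector (spectralMatrix a (measurements a (R • e))) u) :
    ∃ μ : ℝ, 11 / 4 ≤ μ ∧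
      μ • u = (1 / (m : ℝ)) • ∑ r, ((inner ℝ e (a r)) ^ 2 * inner ℝ (a r) u) • a r := by
  have hm' : (0 : ℝ) < m := by exact_mod_cast hm
  obtain ⟨ν, hν, hmax⟩ := hu
  set T := spectralMatrix a (measurements a (R • e)) with hT
  have hsymm : (T : Module.End ℝ (EuclideanSpace ℝ (Fin n))).IsSymmetric := by
    intro x z
    rw [ContinuousLinearMap.coe_coe, real_inner_comm (T z), inner_spectralMatrix,
      inner_spectralMatrix]
    congr 1
    refine Finset.sum_congr rfl fun r _ => ?_
    ring
  have h1 := inner_le_of_forall_eigenvalue_le hsymm hmax he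
  rw [inner_spectralMatrix] at h1
  have h2 : ∑ r, measurements a (R • e) r * (inner ℝ (a r) e * inner ℝ (a r) e) =
      R ^ 2 * ∑ r, (inner ℝ e (a r)) ^ 4 := by
    rw [Finset.mul_sum]
    refine Finset.sum_congr rfl fun r _ => ?_
    rw [measurements_smul, real_inner_comm]
    ring
  rw [h2] at h1
  refine ⟨ν / R ^ 2, ?_, ?_⟩
  · rw [le_div_iff₀ (by positivity)]
    refine le_trans ?_ h1
    have := hG.fourth
    rw [← mul_assoc, mul_comm (1 / (m : ℝ)), mul_assoc, mul_comm]
    gcongr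
    rw [one_div, ← div_eq_inv_mul, le_div_iff₀ hm']
    exact this
  · have h3 : T u = ν • u := hν.apply_eq_smul
    rw [div_eq_inv_mul, mul_smul, ← h3, spectralMatrix_apply, smul_comm, Finset.smul_sum]
    congr 1
    refine Finset.sum_congr rfl fun r _ => ?_
    rw [measurements_smul, smul_smul]
    congr 1
    field_simp

/-- The difference of squares factors as `q (2 t x + q)`, of size at most `3 κ (1 + |x|)²`. The
resulting fourth power is traded for a sixth power because `IsGood` bounds the sixth empirical
moment from above, and the fourth only from below. -/
lemma sq_sub_sq_sq_le {x q t : ℝ} {κ : ℝ} (hκ : κ ≤ 1) (ht : t = 1 ∨ t = -1)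
    (hq : |q| ≤ κ * (1 + |x|)) : ((t * x + q) ^ 2 - x ^ 2) ^ 2 ≤ 72 * κ ^ 2 * (2 + x ^ 6) := by
  have ht2 : t ^ 2 = 1 := by rcases ht with rfl | rfl <;> norm_num
  have ht1 : |t| = 1 := by rcases ht with rfl | rfl <;> norm_num
  have h1 : (t * x + q) ^ 2 - x ^ 2 = q * (2 * (t * x) + q) := by
    have : (t * x) ^ 2 = x ^ 2 := by rw [mul_pow, ht2, one_mul]
    linear_combination this
  have hx0 := abs_nonneg x
  have h2 : |2 * (t * x) + q| ≤ 3 * (1 + |x|) := by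
    refine (abs_add_le _ _).trans ?_
    rw [abs_mul, abs_mul, ht1, abs_two, one_mul]
    nlinarith
  have h3 : q ^ 2 ≤ κ ^ 2 * (1 + |x|) ^ 2 := by
    rw [← mul_pow, ← sq_abs q]
    exact pow_le_pow_left₀ (abs_nonneg _) hq 2
  have h4 : (2 * (t * x) + q) ^ 2 ≤ 9 * (1 + |x|) ^ 2 := by
    rw [← sq_abs]
    refine (pow_le_pow_left₀ (abs_nonneg _) h2 2).trans (le_of_eq ?_)
    ring
  have h5 : (1 + |x|) ^ 4 ≤ 8 * (2 + x ^ 6) := by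
    have h6 : (1 + |x|) ^ 4 ≤ 8 * (1 + |x| ^ 4) := by
      nlinarith [sq_nonneg (1 - |x|), sq_nonneg (1 - |x| ^ 2), sq_nonneg ((1 + |x|) ^ 2)]
    have h7 : |x| ^ 4 ≤ 1 + x ^ 6 := by
      rw [show x ^ 6 = (|x| ^ 2) ^ 3 by rw [sq_abs]; ring, show |x| ^ 4 = (|x| ^ 2) ^ 2 by ring]
      generalize hy : |x| ^ 2 = y
      have : 0 ≤ y := by rw [← hy]; positivity
      nlinarith [sq_nonneg (y - 1), mul_nonneg this (sq_nonneg (y - 1))]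
    linarith
  rw [h1, mul_pow]
  calc q ^ 2 * (2 * (t * x) + q) ^ 2 ≤ (κ ^ 2 * (1 + |x|) ^ 2) * (9 * (1 + |x|) ^ 2) := by gcongr
    _ = 9 * κ ^ 2 * (1 + |x|) ^ 4 := by ring
    _ ≤ 9 * κ ^ 2 * (8 * (2 + x ^ 6)) := by gcongr
    _ = _ := by ring

/-- On the favourable event, spectral initialisers are close to the signal and nearly minimise
the objective. -/
theorem IsGood.spectralInit (hG : IsGood e a ε L H W) (he : ‖e‖ = 1) {R : ℝ} (hR : 0 < R)
    (hn : 0 < n) {g : ℝ} (hL1 : 1 ≤ L) (hLm : L ^ 2 ≤ m) (hW : √L * W ≤ g)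
    (hβ : L * H / m ≤ g ^ 2) (hg : g ≤ 1 / 24) (hε : ε ≤ 1 / 6) (hH : √H * (9 / 11) ^ m ≤ 1)
    {x₀ : EuclideanSpace ℝ (Fin n)} (hx : IsSpectralInit a (measurements a (R • e)) x₀) :
    distTrue (R • e) x₀ ≤ (3 * ε + 12 * g) * R ∧
      objective a (measurements a (R • e)) x₀ ≤ (200 * (3 * ε + 12 * g)) ^ 2 * R ^ 4 := by
  have hm' : (0 : ℝ) < m := by nlinarith
  have hm : 0 < m := by exact_mod_cast hm'
  have hW0 : 0 ≤ W := (norm_nonneg _).trans hG.vec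
  have hε0 : 0 ≤ ε := by
    have := (abs_nonneg _).trans hG.second
    exact nonneg_of_mul_nonneg_left this hm'
  have hWg : W ≤ g := (le_mul_of_one_le_left hW0 (Real.one_le_sqrt.2 hL1)).trans hW
  have hg0 : 0 ≤ g := hW0.trans hWg
  obtain ⟨u, hu1, hu, rfl⟩ := hx
  obtain ⟨μ, hμ, heig⟩ := hG.exists_eigenvalue he hR hm hu
  obtain ⟨s, hs, hs1⟩ := hG.spectralScale_eq hR (by linarith) hn hm
  have hv : ‖perp e u‖ ≤ 2 * g := (hG.norm_perp_eigenvector_le he hu1 hμ heig).trans (by linarith)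
  have hp := hG.abs_inner_perp_le he hu1 hμ heig hL1 hLm hW hβ (by linarith) hH
  set c := inner ℝ e u with hc
  set κ := 3 * ε + 12 * g with hκ
  have hc1 : |c| ≤ 1 := abs_inner_unit_le he hu1
  have hs2 : |s| ≤ 2 := by
    have := abs_sub_abs_le_abs_sub s 1
    rw [abs_one] at this
    linarith
  have hcc : 1 - |c| ≤ 2 * g := by
    have h1 := norm_sq_eq_add_norm_perp_sq he u
    rw [hu1, ← hc, ← sq_abs c] at h1
    have h2 := norm_nonneg (perp e u)
    nlinarith [abs_nonneg c]
  -- The sign `t` selects which of the two true vectors the initialiser is close to.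
  obtain ⟨t, ht, htc⟩ : ∃ t : ℝ, (t = 1 ∨ t = -1) ∧ |s * c - t| ≤ 3 * ε + 2 * g := by
    have habs : |s * |c| - 1| ≤ 3 * ε + 2 * g := by
      have h1 : s * |c| - 1 = (s - 1) * |c| + -(1 - |c|) := by ring
      rw [h1]
      refine (abs_add_le _ _).trans ?_
      rw [abs_mul, abs_abs, abs_neg, abs_of_nonneg (sub_nonneg.2 hc1)]
      have := mul_le_of_le_one_right (abs_nonneg (s - 1)) hc1
      linarith
    rcases le_total 0 c with h | h
    · exact ⟨1, Or.inl rfl, by rwa [abs_of_nonneg h] at habs⟩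
    · refine ⟨-1, Or.inr rfl, ?_⟩
      rw [abs_of_nonpos h] at habs
      rw [show s * c - -1 = -(s * -c - 1) by ring, abs_neg]
      exact habs
  rw [hs]
  constructor
  · have hdec : (R * s) • u - t • (R • e) = R • ((s * c - t) • e + s • perp e u) := by
      have : u = c • e + perp e u := by simp [perp, hc]
      conv_lhs => rw [this]
      module
    have hnorm : ‖(R * s) • u - t • (R • e)‖ ≤ κ * R := by
      rw [hdec, norm_smul, Real.norm_of_nonneg hR.le, mul_comm]
      gcongr
      refine (norm_add_le _ _).trans ?_
      rw [norm_smul, norm_smul, he, mul_one, Real.norm_eq_abs, Real.norm_eq_abs]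
      have : |s| * ‖perp e u‖ ≤ 2 * (2 * g) := mul_le_mul hs2 hv (norm_nonneg _) zero_le_two
      linarith
    rw [distTrue]
    rcases ht with rfl | rfl
    · rw [one_smul] at hnorm
      exact (min_le_left _ _).trans hnorm
    · rw [neg_one_smul, sub_neg_eq_add] at hnorm
      exact (min_le_right _ _).trans hnorm
  · have hterm : ∀ r, ((inner ℝ (a r) ((R * s) • u)) ^ 2 - measurements a (R • e) r) ^ 2 ≤
        R ^ 4 * (72 * κ ^ 2 * (2 + (inner ℝ e (a r)) ^ 6)) := by
      intro r
      set x := inner ℝ e (a r) with hxdef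
      set p := inner ℝ (perp e (a r)) u with hpdef
      have hq : |(s * c - t) * x + s * p| ≤ κ * (1 + |x|) := by
        refine (abs_add_le _ _).trans ?_
        rw [abs_mul, abs_mul]
        have h1 : |s * c - t| * |x| ≤ (3 * ε + 2 * g) * |x| :=
          mul_le_mul_of_nonneg_right htc (abs_nonneg _)
        have h2 : |s| * |p| ≤ 2 * (5 * g * (1 + |x|)) :=
          mul_le_mul hs2 (hp r) (abs_nonneg _) zero_le_two
        rw [hκ]
        nlinarith [abs_nonneg x]
      have h3 := sq_sub_sq_sq_le (κ := κ) (by rw [hκ]; linarith) ht hq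
      rw [measurements_smul, inner_smul_right, inner_eq_perp e (a r) u]
      refine le_trans (le_of_eq ?_) (mul_le_mul_of_nonneg_left h3 (by positivity))
      rw [← hc, ← hxdef, ← hpdef]
      ring
    rw [objective]
    calc _ ≤ 1 / (4 * (m : ℝ)) * ∑ r, R ^ 4 * (72 * κ ^ 2 * (2 + (inner ℝ e (a r)) ^ 6)) := by
          gcongr with r
          exact hterm r
      _ = 18 * κ ^ 2 * R ^ 4 * ((2 * m + ∑ r, (inner ℝ e (a r)) ^ 6) / m) := by
          rw [← Finset.mul_sum, ← Finset.mul_sum, Finset.sum_add_distrib]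
          simp
          field_simp
          ring
      -- 18 · 2002 = 36036 is below 200².
      _ ≤ 18 * κ ^ 2 * R ^ 4 * 2002 := by
          gcongr
          rw [div_le_iff₀ hm']
          linarith [hG.sixth]
      _ ≤ _ := by
          have : 0 ≤ κ ^ 2 * R ^ 4 := by positivity
          nlinarith

end Spectral

/-! ### The Hessian of the entropy -/

section Entropy

variable {n : ℕ}

lemma gradient_entropy (x : EuclideanSpace ℝ (Fin n)) :
    gradient entropy x = (‖x‖ ^ 2 + 1) • x := by
  apply HasGradientAt.gradient
  rw [hasGradientAt_iff_hasFDerivAt]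
  have h := (hasStrictFDerivAt_norm_sq x).hasFDerivAt
  have h2 := ((h.pow 2).const_mul (1 / 4)).add (h.const_mul (1 / 2))
  have hfun : (entropy : EuclideanSpace ℝ (Fin n) → ℝ) =
      fun x => 1 / 4 * (‖x‖ ^ 2) ^ 2 + 1 / 2 * ‖x‖ ^ 2 := by
    funext y
    rw [entropy]
    ring
  rw [hfun]
  refine h2.congr_fderiv ?_
  ext y
  simp
  ring

lemma hessian_entropy_apply (x z : EuclideanSpace ℝ (Fin n)) :
    hessian entropy x z = (‖x‖ ^ 2 + 1) • z + (2 * inner ℝ x z) • x := by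
  have hfun : gradient (entropy : EuclideanSpace ℝ (Fin n) → ℝ) = fun x => (‖x‖ ^ 2 + 1) • x :=
    funext gradient_entropy
  rw [hessian, hfun]
  have h := ((hasStrictFDerivAt_norm_sq x).hasFDerivAt.add_const 1).smul (hasFDerivAt_id x)
  have h2 : fderiv ℝ (fun x : EuclideanSpace ℝ (Fin n) => (‖x‖ ^ 2 + 1) • x) x = _ := h.fderiv
  rw [h2]
  simp

/-- The Hessian is `(‖x‖² + 1) I + 2 x xᵀ`; its largest stretch is in the direction of `x`, which
also gives the matching lower bound when `x ≠ 0`. -/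
lemma norm_hessian_entropy_le (x : EuclideanSpace ℝ (Fin n)) :
    ‖hessian entropy x‖ ≤ 3 * ‖x‖ ^ 2 + 1 := by
  refine ContinuousLinearMap.opNorm_le_bound _ (by positivity) fun z => ?_
  rw [hessian_entropy_apply]
  refine (norm_add_le _ _).trans ?_
  rw [norm_smul, norm_smul, Real.norm_of_nonneg (by positivity), Real.norm_eq_abs, abs_mul, abs_two]
  have := mul_le_mul_of_nonneg_right (abs_real_inner_le_norm x z) (norm_nonneg x)
  nlinarith

lemma le_norm_hessian_entropy {x : EuclideanSpace ℝ (Fin n)} (hx : x ≠ 0) :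
    3 * ‖x‖ ^ 2 + 1 ≤ ‖hessian entropy x‖ := by
  have h := (hessian entropy x).le_opNorm x
  have h2 : hessian entropy x x = (3 * ‖x‖ ^ 2 + 1) • x := by
    rw [hessian_entropy_apply, real_inner_self_eq_norm_sq, ← add_smul]
    congr 1
    ring
  rw [h2, norm_smul, Real.norm_of_nonneg (by positivity)] at h
  exact le_of_mul_le_mul_right h (norm_pos_iff.2 hx)

lemma norm_hessian_entropy_le_of_mem {xbar x : EuclideanSpace ℝ (Fin n)} {ρ : ℝ}
    (hx : x ∈ Metric.closedBall xbar ρ) :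
    ‖hessian entropy x‖ ≤ 3 * (‖xbar‖ + ρ) ^ 2 + 1 := by
  refine (norm_hessian_entropy_le x).trans ?_
  have h1 : ‖x‖ ≤ ‖xbar‖ + ρ := by
    have h2 := norm_le_norm_add_norm_sub' x xbar
    have h3 := mem_closedBall_iff_norm.1 hx
    linarith
  gcongr

lemma Theta_le {xbar : EuclideanSpace ℝ (Fin n)} {ρ : ℝ} (hρ : 0 ≤ ρ) :
    Theta xbar ρ ≤ 3 * (‖xbar‖ + ρ) ^ 2 + 1 := by
  refine csSup_le ⟨_, mem_image_of_mem _ (Metric.mem_closedBall_self hρ)⟩ ?_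
  rintro _ ⟨x, hx, rfl⟩
  exact norm_hessian_entropy_le_of_mem hx

lemma le_Theta {xbar : EuclideanSpace ℝ (Fin n)} (hx : xbar ≠ 0) {ρ : ℝ} (hρ : 0 ≤ ρ) :
    3 * ‖xbar‖ ^ 2 + 1 ≤ Theta xbar ρ := by
  refine (le_norm_hessian_entropy hx).trans
    (le_csSup ?_ (mem_image_of_mem _ (Metric.mem_closedBall_self hρ)))
  refine ⟨3 * (‖xbar‖ + ρ) ^ 2 + 1, ?_⟩
  rintro _ ⟨x, hx, rfl⟩
  exact norm_hessian_entropy_le_of_mem hx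

end Entropy

/-! ### The function `eta1` -/

section Eta

lemma eta1_strictMonoOn_Icc : StrictMonoOn eta1 (Icc 0 1) := by
  intro x hx y hy hxy
  have h1 : √(1 - y) ≤ √(1 - x) := Real.sqrt_le_sqrt (by linarith)
  have h2 : √(2 - 2 * √(1 - x)) ≤ √(2 - 2 * √(1 - y)) := Real.sqrt_le_sqrt (by linarith)
  simp only [eta1]
  linarith

lemma continuous_eta1 : Continuous eta1 := by
  unfold eta1
  fun_prop

lemma eta1_zero : eta1 0 = 0 := by simp [eta1]

lemma eta1_one : eta1 1 = √2 + 1 / 2 := by simp [eta1]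

lemma eta1_strictMonoOn : StrictMonoOn eta1 (Ioo 0 1) :=
  eta1_strictMonoOn_Icc.mono Ioo_subset_Icc_self

lemma eta1_bijOn : BijOn eta1 (Ioo 0 1) (Ioo 0 (√2 + 1 / 2)) := by
  refine ⟨fun x hx => ?_, eta1_strictMonoOn.injOn, fun y hy => ?_⟩
  · rw [← eta1_zero, ← eta1_one]
    exact ⟨eta1_strictMonoOn_Icc (by simp) (Ioo_subset_Icc_self hx) hx.1,
      eta1_strictMonoOn_Icc (Ioo_subset_Icc_self hx) (by simp) hx.2⟩
  · rw [← eta1_zero, ← eta1_one] at hy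
    exact intermediate_value_Ioo zero_le_one continuous_eta1.continuousOn hy

lemma eta1_pos {ϱ : ℝ} (hϱ : ϱ ∈ Ioo (0 : ℝ) 1) : 0 < eta1 ϱ := (eta1_bijOn.mapsTo hϱ).1

lemma eta1_le_of_le_eta1Inv {ϱ t : ℝ} (hϱ : ϱ ∈ Ioo (0 : ℝ) 1) (ht : t ∈ Ioo 0 (√2 + 1 / 2))
    (h : ϱ ≤ eta1Inv t) : eta1 ϱ ≤ t := by
  have him : t ∈ eta1 '' Ioo 0 1 := eta1_bijOn.surjOn ht
  have h1 : eta1Inv t ∈ Ioo (0 : ℝ) 1 := Function.invFunOn_mem him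
  have h2 : eta1 (eta1Inv t) = t := Function.invFunOn_eq him
  rw [← h2]
  exact eta1_strictMonoOn.monotoneOn hϱ h1 h

/-- Needed because `eta1Inv` is a genuine inverse only on the range of `eta1`; elsewhere it takes an
arbitrary value. -/
lemma initThreshold_mem {n : ℕ} (xbar : EuclideanSpace ℝ (Fin n)) {lam : ℝ}
    (hlam : lam ∈ Ioo (0 : ℝ) 1) : initThreshold xbar lam ∈ Ioo 0 (√2 + 1 / 2) := by
  have h0 : 0 < 1 - lam := by linarith [hlam.2]
  have h1 : 0 < max ‖xbar‖ 1 := lt_max_of_lt_right one_pos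
  rw [initThreshold]
  constructor
  · positivity
  · have h2 : 1 ≤ √(3 * (6 * (1 + (1 - lam) ^ 2 / 3) + 1)) := by
      rw [Real.one_le_sqrt]
      nlinarith [sq_nonneg (1 - lam)]
    have h3 : (1 - lam) / √(3 * (6 * (1 + (1 - lam) ^ 2 / 3) + 1)) ≤ 1 := by
      rw [div_le_one (by positivity)]
      linarith [hlam.1]
    have h4 : 1 / max ‖xbar‖ 1 ≤ 1 := by
      rw [div_le_one h1]
      exact le_max_right _ _
    have h5 : 1 < √2 := by
      rw [Real.lt_sqrt zero_le_one]
      norm_num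
    have h6 := mul_le_one₀ h3 (by positivity) h4
    linarith

/-- Below the threshold, the distance bound of the spectral initialiser lies inside the region of
local relative strong convexity. -/
lemma initThreshold_mul_norm_lt {n : ℕ} {xbar : EuclideanSpace ℝ (Fin n)} (hx : xbar ≠ 0) {lam : ℝ}
    (hlam : lam ∈ Ioo (0 : ℝ) 1) : initThreshold xbar lam * ‖xbar‖ <
      localRadius xbar lam / max √(Theta xbar (localRadius xbar lam)) 1 := by
  have hR : 0 < ‖xbar‖ := norm_pos_iff.2 hx
  have h0 : 0 < 1 - lam := by linarith [hlam.2]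
  have h3 : (0 : ℝ) < √3 := by positivity
  set R := ‖xbar‖ with hRdef
  set ρ := localRadius xbar lam with hρ
  set M := max R 1 with hM
  have hM1 : 1 ≤ M := le_max_right _ _
  have hMR : R ≤ M := le_max_left _ _
  have hρ0 : 0 < ρ := by rw [hρ, localRadius]; positivity
  set Q := 6 * (1 + (1 - lam) ^ 2 / 3) + 1 with hQ
  have hQ0 : 0 < Q := by positivity
  have hΘ : Theta xbar ρ < Q * M ^ 2 := by
    refine (Theta_le hρ0.le).trans_lt ?_
    have h4 : ρ = (1 - lam) / √3 * R := by rw [hρ, localRadius]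
    have h5 : ((1 - lam) / √3) ^ 2 = (1 - lam) ^ 2 / 3 := by
      rw [div_pow, Real.sq_sqrt (by norm_num)]
    set d := (1 - lam) / √3 with hd
    have h6 : d < 1 := by
      rw [hd, div_lt_one h3]
      have : 1 < √3 := by
        rw [Real.lt_sqrt zero_le_one]
        norm_num
      linarith [hlam.1]
    rw [hQ, ← h5, ← hRdef, h4]
    -- Strict because `d < 1`; this strictness is what places the initialiser in the open ball.
    have h7 : (1 + d) ^ 2 < 2 * (1 + d ^ 2) := by nlinarith [sq_pos_of_pos (sub_pos.2 h6)]
    have h8 : R ^ 2 ≤ M ^ 2 := pow_le_pow_left₀ hR.le hMR 2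
    have h9 : 1 ≤ M ^ 2 := one_le_pow₀ hM1
    have h10 : 0 < R ^ 2 := by positivity
    calc 3 * (R + d * R) ^ 2 + 1 = 3 * (1 + d) ^ 2 * R ^ 2 + 1 := by ring
      _ < 3 * (2 * (1 + d ^ 2)) * R ^ 2 + 1 := by gcongr
      _ ≤ 3 * (2 * (1 + d ^ 2)) * M ^ 2 + 1 * M ^ 2 := by
          rw [one_mul]
          gcongr
      _ = _ := by ring
  have hmax : max √(Theta xbar ρ) 1 < √Q * M := by
    rw [max_lt_iff]
    constructor
    · rw [← Real.sqrt_sq (zero_le_one.trans hM1), ← Real.sqrt_mul hQ0.le]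
      exact Real.sqrt_lt_sqrt (by
        have := le_Theta hx hρ0.le
        have : 0 ≤ ‖xbar‖ ^ 2 := by positivity
        linarith) hΘ
    · have : 1 < √Q := by
        rw [Real.lt_sqrt zero_le_one, hQ]
        nlinarith [sq_nonneg (1 - lam)]
      nlinarith
  -- The threshold is built for this identity: `√(3 Q) = √3 √Q`, and the factor `√3` goes into `ρ`.
  have heq : initThreshold xbar lam * R = ρ / (√Q * M) := by
    rw [initThreshold, ← hQ, hρ, localRadius, Real.sqrt_mul (by norm_num), ← hRdef, ← hM]
    have : 0 < √Q := Real.sqrt_pos.2 hQ0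
    field_simp
  rw [heq]
  exact div_lt_div_of_pos_left hρ0 (lt_max_of_lt_right one_pos) hmax

end Eta

/-! ### The favourable event is likely -/

lemma measure_iUnion_le_ofReal {α ι : Type*} [MeasurableSpace α] [Fintype ι] {ν : Measure α}
    {B : ι → Set α} {x : ℝ} (h : ∀ i, ν (B i) ≤ ENNReal.ofReal x) :
    ν (⋃ i, B i) ≤ ENNReal.ofReal (Fintype.card ι * x) := by
  refine (measure_iUnion_fintype_le ν B).trans ((Finset.sum_le_sum fun i _ => h i).trans ?_)
  rw [ENNReal.ofReal_mul (by positivity)]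
  simp

section Probability

variable {n m : ℕ}

local notation "𝔼n" => EuclideanSpace ℝ (Fin n)
local notation "ν" => Measure.pi fun _ : Fin m => stdGaussian (EuclideanSpace ℝ (Fin n))

variable {e : EuclideanSpace ℝ (Fin n)} {ε L H W g t : ℝ}

lemma measure_fourth_le (he : ‖e‖ = 1) (ht : 1000000 * t ≤ m) :
    (ν) {a | ¬ (11 / 4 * (m : ℝ) ≤ ∑ r, (inner ℝ e (a r)) ^ 4)} ≤
      ENNReal.ofReal (Real.exp (-t)) := by
  -- At `θ = 1/50000` the log-moment is `-2.9 θ` per sample against the target `-2.75 θ`; the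
  -- difference leaves `3 · 10⁻⁶ m` for `t`.
  have h := pi_measure_sum_le_exp (μ := stdGaussian 𝔼n) (m := m)
    (φ := fun x => -(1 / 50000 * (inner ℝ e x) ^ 4)) (by fun_prop)
    (c := -(3 * (1 / 50000)) + 5000 * (1 / 50000) ^ 2) (by
      rw [lintegral_inner_unit_stdGaussian he
        (F := fun s => ENNReal.ofReal (Real.exp (-(1 / 50000 * s ^ 4)))) (by fun_prop)]
      exact lintegral_exp_neg_mul_pow_four_gaussianReal_le (by norm_num)) t
  refine (measure_mono fun a ha => ?_).trans h
  simp only [mem_ofPred_eq, not_le] at ha ⊢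
  rw [Finset.sum_neg_distrib, ← Finset.mul_sum]
  linarith

lemma measure_sq_le (he : ‖e‖ = 1) (hL : 2 + 4 * t ≤ L) :
    (ν) {a | ¬ ∀ s, (inner ℝ e (a s)) ^ 2 ≤ L} ≤ ENNReal.ofReal (m * Real.exp (-t)) := by
  have h : ∀ s, (ν) {a | 1 / 4 + 4 * (1 / 4) ^ 2 + t ≤ 1 / 4 * (inner ℝ e (a s)) ^ 2} ≤
      ENNReal.ofReal (Real.exp (-t)) := fun s =>
    pi_measure_eval_le_exp (μ := stdGaussian 𝔼n) (φ := fun x => 1 / 4 * (inner ℝ e x) ^ 2)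
      (by fun_prop) (lintegral_exp_inner_sq_le he.le (by norm_num) le_rfl) t s
  have h2 := measure_iUnion_le_ofReal h
  rw [Fintype.card_fin] at h2
  refine (measure_mono fun a ha => ?_).trans h2
  simp only [mem_ofPred_eq, not_forall, not_le] at ha
  obtain ⟨s, hs⟩ := ha
  refine mem_iUnion.2 ⟨s, ?_⟩
  simp only [mem_ofPred_eq]
  linarith

lemma measure_norm_le (hH : 2 * n + 4 * t ≤ H) :
    (ν) {a | ¬ ∀ s, ‖a s‖ ^ 2 ≤ H} ≤ ENNReal.ofReal (m * Real.exp (-t)) := by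
  have h : ∀ s, (ν) {a | n * (1 / 4 + 4 * (1 / 4) ^ 2) + t ≤ 1 / 4 * ‖a s‖ ^ 2} ≤
      ENNReal.ofReal (Real.exp (-t)) := fun s =>
    pi_measure_eval_le_exp (μ := stdGaussian 𝔼n) (φ := fun x => 1 / 4 * ‖x‖ ^ 2)
      (by fun_prop) (lintegral_exp_norm_sq_le (by norm_num)) t s
  have h2 := measure_iUnion_le_ofReal h
  rw [Fintype.card_fin] at h2
  refine (measure_mono fun a ha => ?_).trans h2
  simp only [mem_ofPred_eq, not_forall, not_le] at ha
  obtain ⟨s, hs⟩ := ha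
  refine mem_iUnion.2 ⟨s, ?_⟩
  simp only [mem_ofPred_eq]
  linarith

/-- On the event that all `α_r²` are at most `L` the truncation is inactive, so the bad event is
intersected with it. The parameter `1/L³` is the largest that the truncated moment allows, and 800 =
2000 - 1200. -/
lemma measure_sixth_le (he : ‖e‖ = 1) (hL : 0 < L) (ht : L ^ 3 * t ≤ 800 * m) :
    (ν) {a | (∀ s, (inner ℝ e (a s)) ^ 2 ≤ L) ∧ ¬ ∑ r, (inner ℝ e (a r)) ^ 6 ≤ 2000 * (m : ℝ)} ≤
      ENNReal.ofReal (Real.exp (-t)) := by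
  have hmeas : Measurable fun s : ℝ => if s ^ 2 ≤ L then 1 / L ^ 3 * s ^ 6 else 0 :=
    Measurable.ite (measurableSet_le (by fun_prop) (by fun_prop)) (by fun_prop) (by fun_prop)
  have h := pi_measure_sum_le_exp (μ := stdGaussian 𝔼n) (m := m)
    (φ := fun x => if (inner ℝ e x) ^ 2 ≤ L then 1 / L ^ 3 * (inner ℝ e x) ^ 6 else 0)
    (hmeas.comp (by fun_prop)) (c := 1200 * (1 / L ^ 3)) (by
      rw [lintegral_inner_unit_stdGaussian he
        (F := fun s => ENNReal.ofReal (Real.exp (if s ^ 2 ≤ L then 1 / L ^ 3 * s ^ 6 else 0)))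
        (by fun_prop)]
      exact lintegral_exp_indicator_pow_six_gaussianReal_le (by positivity)
        (by rw [one_div, inv_mul_cancel₀ (by positivity)])) t
  refine (measure_mono fun a ha => ?_).trans h
  obtain ⟨h1, h2⟩ := ha
  simp only [mem_ofPred_eq, not_le, h1, if_true] at h2 ⊢
  rw [← Finset.mul_sum]
  have h3 : 0 < L ^ 3 := by positivity
  rw [← mul_le_mul_iff_right₀ h3]
  have h4 : L ^ 3 * (m * (1200 * (1 / L ^ 3)) + t) = 1200 * m + L ^ 3 * t := by
    field_simp
  have h5 : L ^ 3 * (1 / L ^ 3 * ∑ r, (inner ℝ e (a r)) ^ 6) = ∑ r, (inner ℝ e (a r)) ^ 6 := by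
    field_simp
  rw [h4, h5]
  linarith

/-- Covers both the signal direction (`d = 1`) and the full norms (`d = n`). With `θ = ±ε/8`, half
of the gain `ε² d m / 8` pays for the quadratic term and half for `t`. -/
lemma measure_abs_sum_sub_le {E : Type*} [MeasurableSpace E] {μ : Measure E}
    [IsProbabilityMeasure μ] {q : E → ℝ} (hq : Measurable q) {d : ℝ} (hd : 1 ≤ d)
    (h : ∀ θ : ℝ, |θ| ≤ 1 / 4 → ∫⁻ x, ENNReal.ofReal (Real.exp (θ * q x)) ∂μ ≤
      ENNReal.ofReal (Real.exp (d * (θ + 4 * θ ^ 2)))) (hε0 : 0 < ε) (hε : ε ≤ 1)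
    (ht : 16 * t ≤ ε ^ 2 * m) :
    (Measure.pi fun _ : Fin m => μ) {a | ¬ |∑ r, q (a r) - d * m| ≤ ε * (d * m)} ≤
      ENNReal.ofReal (2 * Real.exp (-t)) := by
  have hδ : |ε / 8| ≤ 1 / 4 := by rw [abs_of_pos (by positivity)]; linarith
  have h1 := pi_measure_sum_le_exp (m := m) (φ := fun x => ε / 8 * q x) (by fun_prop)
    (h (ε / 8) hδ) t
  have h2 := pi_measure_sum_le_exp (m := m) (φ := fun x => -(ε / 8) * q x) (by fun_prop)
    (h (-(ε / 8)) (by rwa [abs_neg])) t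
  rw [two_mul, ENNReal.ofReal_add (Real.exp_pos _).le (Real.exp_pos _).le]
  refine (measure_mono fun a ha => ?_).trans ((measure_union_le _ _).trans (add_le_add h1 h2))
  simp only [mem_ofPred_eq, not_le, mem_union, ← Finset.mul_sum] at ha ⊢
  have ht' : 16 * t ≤ ε ^ 2 * (d * m) := by
    refine ht.trans ?_
    gcongr
    exact le_mul_of_one_le_left (by positivity) hd
  rcases lt_abs.1 ha with h3 | h3
  · left
    have : ε * (ε * (d * m)) < ε * (∑ r, q (a r) - d * m) := by gcongr
    nlinarith
  · right
    have : ε * (ε * (d * m)) < ε * (-(∑ r, q (a r) - d * m)) := by gcongr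
    nlinarith

lemma measure_second_le (he : ‖e‖ = 1) (hε0 : 0 < ε) (hε : ε ≤ 1)
    (ht : 16 * t ≤ ε ^ 2 * m) :
    (ν) {a | ¬ |∑ r, (inner ℝ e (a r)) ^ 2 - m| ≤ ε * m} ≤
      ENNReal.ofReal (2 * Real.exp (-t)) := by
  have := measure_abs_sum_sub_le (μ := stdGaussian 𝔼n) (q := fun x => (inner ℝ e x) ^ 2)
    (by fun_prop) (d := 1) le_rfl (fun θ hθ => by
      rw [lintegral_inner_unit_stdGaussian he
        (F := fun s => ENNReal.ofReal (Real.exp (θ * s ^ 2))) (by fun_prop), one_mul]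
      exact lintegral_exp_mul_sq_gaussianReal_le hθ) hε0 hε ht
  simpa only [one_mul] using this

lemma measure_norms_le (hn : 1 ≤ n) (hε0 : 0 < ε) (hε : ε ≤ 1)
    (ht : 16 * t ≤ ε ^ 2 * m) :
    (ν) {a | ¬ |∑ r, ‖a r‖ ^ 2 - n * m| ≤ ε * (n * m)} ≤
      ENNReal.ofReal (2 * Real.exp (-t)) :=
  measure_abs_sum_sub_le (μ := stdGaussian 𝔼n) (q := fun x => ‖x‖ ^ 2) (by fun_prop)
    (by exact_mod_cast hn) (fun _ hθ => lintegral_exp_norm_sq_le hθ) hε0 hε ht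

lemma norm_perp_le_one (he : ‖e‖ = 1) {c : 𝔼n} (hc : ‖c‖ ≤ 1) : ‖perp e c‖ ≤ 1 :=
  (norm_perp_le he c).trans hc

/-- The level `5 (n + t) + 1` pays for a union bound over a net, through `9 ≤ e³` and `2 ≤ e`. -/
lemma card_mul_exp_le {N : ℕ} (hN : N ≤ 9 ^ n) (ht0 : 0 ≤ t) :
    (N : ℝ) * (2 * Real.exp (-(5 * (n + t) + 1))) ≤ Real.exp (-t) := by
  have h9 : (9 : ℝ) ≤ Real.exp 3 := by
    have := Real.add_one_le_exp (1 : ℝ)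
    have h3 : Real.exp 3 = Real.exp 1 ^ 3 := by
      rw [← Real.exp_nat_mul]
      norm_num
    have h4 : (2.7182818283 : ℝ) < Real.exp 1 := Real.exp_one_gt_d9
    rw [h3]
    nlinarith [pow_le_pow_left₀ (by norm_num) h4.le 3]
  have h2 : (2 : ℝ) ≤ Real.exp 1 := by linarith [Real.add_one_le_exp (1 : ℝ)]
  calc (N : ℝ) * (2 * Real.exp (-(5 * (n + t) + 1)))
      ≤ Real.exp 3 ^ n * (Real.exp 1 * Real.exp (-(5 * (n + t) + 1))) := by
        gcongr
        calc (N : ℝ) ≤ (9 : ℝ) ^ n := by exact_mod_cast hN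
          _ ≤ _ := by gcongr
    _ = Real.exp (3 * n + (1 + -(5 * (n + t) + 1))) := by
        rw [← Real.exp_nat_mul, ← Real.exp_add, ← Real.exp_add]
        ring_nf
    _ ≤ Real.exp (-t) := by
        gcongr
        have : (0 : ℝ) ≤ n := by positivity
        linarith

lemma measure_op_le (he : ‖e‖ = 1) (hL : 0 < L) (hε : ε ≤ 1 / 24) (ht0 : 0 ≤ t)
    (ht : 800 * L * (5 * (n + t) + 1) ≤ m) :
    (ν) {a | (∀ s, (inner ℝ e (a s)) ^ 2 ≤ L) ∧ |∑ r, (inner ℝ e (a r)) ^ 2 - m| ≤ ε * m ∧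
      ¬ ∀ z, ∑ r, (inner ℝ e (a r)) ^ 2 * (inner ℝ (perp e (a r)) z) ^ 2 ≤
        9 / 4 * m * ‖z‖ ^ 2} ≤ ENNReal.ofReal (Real.exp (-t)) := by
  obtain ⟨N, hcard, hN1, hN⟩ := exists_quarter_net (E := 𝔼n)
  rw [finrank_euclideanSpace_fin] at hcard
  set θ := 1 / (40 * L) with hθ
  set T := 5 * (n + t) + 1 with hT
  let φ : 𝔼n → 𝔼n → ℝ := fun c x => if (inner ℝ e x) ^ 2 ≤ L then
      θ * ((inner ℝ e x) ^ 2 * (inner ℝ (perp e c) x) ^ 2) -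
        11 / 10 * (θ * (inner ℝ e x) ^ 2) else 0
  have hφ : ∀ c, Measurable (φ c) := fun c =>
    Measurable.ite (measurableSet_le (by fun_prop) (by fun_prop)) (by fun_prop) (by fun_prop)
  have h : ∀ c : N, (ν) {a | m * 0 + T ≤ ∑ r, φ c (a r)} ≤
      ENNReal.ofReal (2 * Real.exp (-T)) := fun c => by
    refine (pi_measure_sum_le_exp (μ := stdGaussian 𝔼n) (hφ c)
      (lintegral_exp_sq_mul_sq_le he (norm_perp_le_one he (hN1 c c.2)) (inner_perp he _)
      (by positivity) (le_of_eq ?_)) T).trans (ENNReal.ofReal_le_ofReal ?_)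
    · rw [hθ]; field_simp
    · linarith [Real.exp_pos (-T)]
  have h2 := (measure_iUnion_le_ofReal h).trans (ENNReal.ofReal_le_ofReal
    (by simpa only [Fintype.card_coe] using card_mul_exp_le hcard ht0))
  refine (measure_mono ?_).trans h2
  rintro a ⟨hsq, hsec, hop⟩
  by_contra hcon
  apply hop
  simp only [mem_iUnion, mem_ofPred_eq, not_exists, not_le, φ, hsq, if_true, Finset.sum_sub_distrib,
    ← Finset.mul_sum, mul_zero, zero_add] at hcon
  have hm0 : (0 : ℝ) ≤ m := by positivity
  -- The compensator contributes at most `11/10 · 25/24 m` and the deviation `40 L T ≤ m/20`,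
  -- together below `5/4 m`.
  have hquad : ∀ c ∈ N, ∑ r, (inner ℝ e (a r)) ^ 2 * (inner ℝ (perp e c) (a r)) ^ 2 ≤
      5 / 4 * m := by
    intro c hc
    have h3 := hcon ⟨c, hc⟩
    have h4 := (abs_le.1 hsec).2
    have h5 : ∑ r, (inner ℝ e (a r)) ^ 2 ≤ 25 / 24 * m := by nlinarith
    have h6 : ∑ r, (inner ℝ e (a r)) ^ 2 * (inner ℝ (perp e c) (a r)) ^ 2 <
        11 / 10 * ∑ r, (inner ℝ e (a r)) ^ 2 + 40 * L * T := by
      have h7 : (0 : ℝ) < 40 * L := by positivity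
      have h8 := mul_lt_mul_of_pos_left h3 h7
      have h9 : 40 * L * θ = 1 := by rw [hθ]; field_simp
      dsimp only at h8
      rw [mul_sub, ← mul_assoc (40 * L) θ, h9] at h8
      have h10 : 40 * L * (11 / 10 * (θ * ∑ r, (inner ℝ e (a r)) ^ 2)) =
        11 / 10 * (40 * L * θ) * ∑ r, (inner ℝ e (a r)) ^ 2 := by ring
      rw [h10, h9] at h8
      linarith
    linarith
  -- The quadratic form is `‖A z‖²`, so the net argument applies to the linear map `A`; its loss
  -- `(4/3)²` turns 5/4 into 20/9, still below 9/4.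
  let A : 𝔼n →ₗ[ℝ] EuclideanSpace ℝ (Fin m) :=
    { toFun := fun z => WithLp.toLp 2 fun r => inner ℝ e (a r) * inner ℝ (perp e (a r)) z
      map_add' := fun x y => by
        ext r
        simp [inner_add_right, mul_add]
      map_smul' := fun c x => by
        ext r
        simp [inner_smul_right]
        ring }
  have hA : ∀ z, ‖LinearMap.toContinuousLinearMap A z‖ ^ 2 =
      ∑ r, (inner ℝ e (a r)) ^ 2 * (inner ℝ (perp e (a r)) z) ^ 2 := fun z => by
    rw [EuclideanSpace.real_norm_sq_eq]
    simp [A, mul_pow]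
  intro z
  have h11 := norm_apply_le_of_net hN (LinearMap.toContinuousLinearMap A) (t := √(5 / 4 * m))
    (fun c hc => Real.le_sqrt_of_sq_le (by
      rw [hA]
      refine le_trans (le_of_eq ?_) (hquad c hc)
      refine Finset.sum_congr rfl fun r _ => ?_
      rw [inner_perp_left, real_inner_comm (perp e c)])) z
  rw [← hA]
  calc _ ≤ (4 / 3 * √(5 / 4 * m) * ‖z‖) ^ 2 := pow_le_pow_left₀ (norm_nonneg _) h11 2
    _ = 16 / 9 * (5 / 4 * m) * ‖z‖ ^ 2 := by
        rw [mul_pow, mul_pow, Real.sq_sqrt (by positivity)]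
        ring
    _ ≤ _ := by nlinarith [mul_nonneg hm0 (sq_nonneg ‖z‖)]

lemma measure_vec_le (he : ‖e‖ = 1) (hm : 0 < m) (ht0 : 0 ≤ t) :
    (ν) {a | ∑ r, (inner ℝ e (a r)) ^ 6 ≤ 2000 * (m : ℝ) ∧
      ¬ ‖perpVec e a Finset.univ‖ ≤ 200 * √((5 * (n + t) + 1) / m)} ≤
      ENNReal.ofReal (Real.exp (-t)) := by
  obtain ⟨N, hcard, hN1, hN⟩ := exists_quarter_net (E := 𝔼n)
  rw [finrank_euclideanSpace_fin] at hcard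
  have hm' : (0 : ℝ) < m := by exact_mod_cast hm
  set T := 5 * (n + t) + 1 with hT
  have hT0 : 0 < T := by positivity
  set S := √(T / m) with hS
  have hS0 : 0 < S := Real.sqrt_pos.2 (by positivity)
  have hS2 : m * S ^ 2 = T := by
    rw [hS, Real.sq_sqrt (by positivity)]
    field_simp
  -- With this choice the compensator is at most `10 m S²` and the deviation level is `m S²`, so the
  -- sum is at most `110 S m`. The net factor 4/3 applied to 150 then gives 200.
  set θ := S / 10 with hθ
  have h : ∀ c : N, (ν) ({a | m * 0 + T ≤ ∑ r, (θ * ((inner ℝ e (a r)) ^ 3 *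
      inner ℝ (perp e c) (a r)) - θ ^ 2 / 2 * (inner ℝ e (a r)) ^ 6)} ∪
      {a | m * 0 + T ≤ ∑ r, (-θ * ((inner ℝ e (a r)) ^ 3 *
      inner ℝ (perp e c) (a r)) - (-θ) ^ 2 / 2 * (inner ℝ e (a r)) ^ 6)}) ≤
      ENNReal.ofReal (2 * Real.exp (-T)) := fun c => by
    rw [two_mul, ENNReal.ofReal_add (Real.exp_pos _).le (Real.exp_pos _).le]
    have hc : ∀ θ : ℝ, _ := fun θ => pi_measure_sum_le_exp (μ := stdGaussian 𝔼n) (m := m)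
      (φ := fun x => θ * ((inner ℝ e x) ^ 3 * inner ℝ (perp e c) x) -
        θ ^ 2 / 2 * (inner ℝ e x) ^ 6) (by fun_prop)
      (lintegral_exp_cube_mul_le he (norm_perp_le_one he (hN1 c c.2)) (inner_perp he _) θ) T
    exact (measure_union_le _ _).trans (add_le_add (hc θ) (hc (-θ)))
  have h2 := (measure_iUnion_le_ofReal h).trans (ENNReal.ofReal_le_ofReal
    (by simpa only [Fintype.card_coe] using card_mul_exp_le hcard ht0))
  refine (measure_mono ?_).trans h2
  rintro a ⟨hsix, hvec⟩
  by_contra hcon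
  apply hvec
  simp only [mem_iUnion, mem_union, mem_ofPred_eq, not_exists, not_or, not_le,
    Finset.sum_sub_distrib, ← Finset.mul_sum, mul_zero, zero_add, neg_sq] at hcon
  have hlin : ∀ c ∈ N, |inner ℝ (perpVec e a Finset.univ) c| ≤ 150 * S := by
    intro c hc
    obtain ⟨h3, h4⟩ := hcon ⟨c, hc⟩
    dsimp only at h3 h4
    have h5 : inner ℝ (perpVec e a Finset.univ) c =
        1 / (m : ℝ) * ∑ r, (inner ℝ e (a r)) ^ 3 * inner ℝ (perp e c) (a r) := by
      rw [perpVec, real_inner_smul_left, sum_inner]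
      congr 1
      refine Finset.sum_congr rfl fun r _ => ?_
      rw [real_inner_smul_left, inner_perp_left, real_inner_comm (perp e c)]
    set X := ∑ r, (inner ℝ e (a r)) ^ 3 * inner ℝ (perp e c) (a r) with hX
    have h6 : θ ^ 2 / 2 * ∑ r, (inner ℝ e (a r)) ^ 6 ≤ 10 * (m * S ^ 2) := by
      calc _ ≤ θ ^ 2 / 2 * (2000 * m) := by gcongr
        _ = _ := by rw [hθ]; ring
    have h7 : |X| ≤ 150 * S * m := by
      have h8 : |X| * (S / 10) ≤ 15 * S * m * S := by
        rw [← abs_of_pos (show 0 < S / 10 by positivity), ← abs_mul, abs_le]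
        rw [← hθ]
        constructor <;> nlinarith
      nlinarith
    rw [h5, abs_mul, abs_of_pos (show (0 : ℝ) < 1 / m by positivity), one_div,
      inv_mul_le_iff₀ hm']
    linarith
  have h9 := norm_apply_le_of_net hN (innerSL ℝ (perpVec e a Finset.univ)) (t := 150 * S)
    (fun c hc => hlin c hc) (perpVec e a Finset.univ)
  rw [innerSL_apply_apply, real_inner_self_eq_norm_sq, Real.norm_of_nonneg (sq_nonneg _)] at h9
  rcases (norm_nonneg (perpVec e a Finset.univ)).eq_or_lt with h0 | h0
  · rw [← h0]; positivity
  · refine le_of_mul_le_mul_right ?_ h0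
    linarith

lemma perpOp_update {s : Fin m} (a : Fin m → 𝔼n) (x z : 𝔼n) :
    perpOp e (Function.update a s x) (Finset.univ.erase s) z =
      perpOp e a (Finset.univ.erase s) z := by
  unfold perpOp
  congr 1
  refine Finset.sum_congr rfl fun r hr => ?_
  rw [Function.update_of_ne (Finset.ne_of_mem_erase hr)]

lemma perpVec_update {s : Fin m} (a : Fin m → 𝔼n) (x : 𝔼n) :
    perpVec e (Function.update a s x) (Finset.univ.erase s) =
      perpVec e a (Finset.univ.erase s) := by
  unfold perpVec
  congr 1
  refine Finset.sum_congr rfl fun r hr => ?_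
  rw [Function.update_of_ne (Finset.ne_of_mem_erase hr)]

/-- Supplies the measurability that the resampling lemma requires. -/
lemma continuous_iterate_perpOp (J : Finset (Fin m)) (k : ℕ) :
    Continuous fun a : Fin m → 𝔼n => (perpOp e a J)^[k] (perpVec e a J) := by
  induction k with
  | zero =>
    simp only [Function.iterate_zero, id_eq, perpVec]
    fun_prop
  | succ k ih =>
    simp only [Function.iterate_succ_apply']
    rw [show (fun a : Fin m → 𝔼n => perpOp e a J ((perpOp e a J)^[k] (perpVec e a J))) =
      fun a => (1 / (m : ℝ)) • ∑ r ∈ J, ((inner ℝ e (a r)) ^ 2 * inner ℝ (perp e (a r))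
        ((perpOp e a J)^[k] (perpVec e a J))) • perp e (a r) from rfl]
    fun_prop

lemma measure_inner_sq_gt_le (he : ‖e‖ = 1) (hL : 2 + 4 * t ≤ L) (z : 𝔼n) :
    stdGaussian 𝔼n {x | L * ‖z‖ ^ 2 < (inner ℝ (perp e x) z) ^ 2} ≤
      ENNReal.ofReal (Real.exp (-t)) := by
  rcases eq_or_ne z 0 with rfl | hz
  · simp
  have hz0 : 0 < ‖z‖ := norm_pos_iff.2 hz
  set f := ‖z‖⁻¹ • perp e z with hf
  have hf1 : ‖f‖ ≤ 1 := by
    rw [hf, norm_smul, norm_inv, norm_norm, inv_mul_le_one₀ hz0]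
    exact norm_perp_le he z
  have h := measure_le_exp_of_lintegral_exp_le (φ := fun x => 1 / 4 * (inner ℝ f x) ^ 2)
    (by fun_prop) (lintegral_exp_inner_sq_le hf1 (by norm_num) le_rfl) t
  refine (measure_mono fun x hx => ?_).trans h
  simp only [mem_ofPred_eq] at hx ⊢
  have h1 : inner ℝ (perp e x) z = ‖z‖ * inner ℝ f x := by
    rw [hf, real_inner_smul_left, inner_perp_left, real_inner_comm, ← mul_assoc,
      mul_inv_cancel₀ hz0.ne', one_mul]
  rw [h1, mul_pow, mul_comm L] at hx
  have h2 := lt_of_mul_lt_mul_left hx (by positivity)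
  linarith

/-- Resampling `a_s` leaves the iterates built without it unchanged, so with the other coordinates
frozen this is a one-dimensional Gaussian tail against a fixed vector. The union over `s` and `k`
costs `m²`. -/
lemma measure_leaveOneOut_le (he : ‖e‖ = 1) (hL : 2 + 4 * t ≤ L) :
    (ν) {a | ¬ ∀ s, ∀ k < m, (inner ℝ (perp e (a s))
      ((perpOp e a (Finset.univ.erase s))^[k] (perpVec e a (Finset.univ.erase s)))) ^ 2 ≤
      L * ‖(perpOp e a (Finset.univ.erase s))^[k] (perpVec e a (Finset.univ.erase s))‖ ^ 2} ≤
      ENNReal.ofReal (m * (m * Real.exp (-t))) := by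
  have h : ∀ s : Fin m, (ν) (⋃ k : Fin m, {a | L * ‖(perpOp e a (Finset.univ.erase s))^[(k : ℕ)]
      (perpVec e a (Finset.univ.erase s))‖ ^ 2 < (inner ℝ (perp e (a s))
      ((perpOp e a (Finset.univ.erase s))^[(k : ℕ)] (perpVec e a (Finset.univ.erase s)))) ^ 2}) ≤
      ENNReal.ofReal (m * Real.exp (-t)) := fun s => by
    refine (measure_iUnion_le_ofReal fun k => ?_).trans (by rw [Fintype.card_fin])
    have hc := continuous_iterate_perpOp (e := e) (Finset.univ.erase s) (k : ℕ)
    refine pi_measure_le_of_update (IsOpen.measurableSet (isOpen_lt (by fun_prop)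
      (by fun_prop))) s fun a => ?_
    simp only [mem_ofPred_eq, perpVec_update, Function.update_self]
    have hop : ∀ x, perpOp e (Function.update a s x) (Finset.univ.erase s) =
        perpOp e a (Finset.univ.erase s) := fun x => funext fun z => perpOp_update a x z
    simp only [hop]
    exact measure_inner_sq_gt_le he hL _
  have h2 := measure_iUnion_le_ofReal h
  rw [Fintype.card_fin] at h2
  refine (measure_mono fun a ha => ?_).trans h2
  simp only [mem_ofPred_eq, not_forall, not_le] at ha
  obtain ⟨s, k, hk, hs⟩ := ha
  exact mem_iUnion.2 ⟨s, mem_iUnion.2 ⟨⟨k, hk⟩, hs⟩⟩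

end Probability

/-! ### Choice of parameters, transfer to the probability space, and the three claims. -/

section Conclusion

variable {n m : ℕ}

/-- The favourable event fails with probability `O(m⁻²)`. -/
lemma measure_not_isGood_le {e : EuclideanSpace ℝ (Fin n)} (he : ‖e‖ = 1) {ε : ℝ} (hn : 1 ≤ n)
    (hm : 0 < m) (hε0 : 0 < ε) (hε : ε ≤ 1 / 24) (hl : 1 ≤ Real.log m)
    (h1 : 10000000 * (Real.log m * (n + Real.log m)) ≤ m) (h2 : 32 * Real.log m ≤ ε ^ 2 * m)
    (h3 : 15 * Real.log m ^ 4 ≤ m) :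
    (Measure.pi fun _ : Fin m => stdGaussian (EuclideanSpace ℝ (Fin n)))
      {a | ¬ IsGood e a ε (18 * Real.log m) (12 * (n + Real.log m))
        (200 * √((5 * (n + 2 * Real.log m) + 1) / m))} ≤ ENNReal.ofReal (11 / (m : ℝ) ^ 2) := by
  have hm' : (0 : ℝ) < m := by exact_mod_cast hm
  have hn' : (1 : ℝ) ≤ n := by exact_mod_cast hn
  set l := Real.log m with hldef
  have hexp : ∀ k : ℕ, Real.exp (-(k * l)) = 1 / (m : ℝ) ^ k := fun k => by
    rw [Real.exp_neg, Real.exp_nat_mul, hldef, Real.exp_log hm', one_div]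
  have hm1 : (1 : ℝ) ≤ m := by exact_mod_cast hm
  have e2 : Real.exp (-(2 * l)) = 1 / (m : ℝ) ^ 2 := by exact_mod_cast hexp 2
  have e3 : (m : ℝ) * Real.exp (-(3 * l)) = 1 / (m : ℝ) ^ 2 := by
    have : Real.exp (-(3 * l)) = 1 / (m : ℝ) ^ 3 := by exact_mod_cast hexp 3
    rw [this]
    field_simp
  have e4 : (m : ℝ) * (m * Real.exp (-(4 * l))) = 1 / (m : ℝ) ^ 2 := by
    have : Real.exp (-(4 * l)) = 1 / (m : ℝ) ^ 4 := by exact_mod_cast hexp 4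
    rw [this]
    field_simp
  have hln : l * n + l * l ≤ m / 10000000 := by linarith
  have hll : l ≤ l * l := by nlinarith
  have hln1 : n ≤ l * n := by nlinarith
  set L := 18 * l with hL
  -- The level is `2 l`, `3 l` or `4 l` according to whether the union bound costs a constant, `m`
  -- or `m²`, so each event has order `m⁻²`. Seven events count once and the two two-sided ones
  -- twice: 11 in all.
  have p1 := measure_fourth_le (n := n) (m := m) he (t := 2 * l) (by nlinarith)
  have p2 := measure_sq_le (n := n) (m := m) he (t := 3 * l) (L := L) (by linarith)
  have p3 := measure_norm_le (n := n) (m := m) (t := 3 * l) (H := 12 * (n + l)) (by linarith)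
  have p4 := measure_sixth_le (n := n) (m := m) he (t := 2 * l) (L := L) (by linarith) (by
    rw [hL]
    nlinarith)
  have p5 := measure_second_le (n := n) (m := m) he (t := 2 * l) hε0 (by linarith) (by linarith)
  have p6 := measure_norms_le (n := n) (m := m) hn (t := 2 * l) hε0 (by linarith) (by linarith)
  have p7 := measure_op_le (n := n) (m := m) he (t := 2 * l) (L := L) (by linarith) hε
    (by linarith) (by rw [hL]; nlinarith)
  have p8 := measure_vec_le (n := n) (m := m) he hm (t := 2 * l) (by linarith)
  have p9 := measure_leaveOneOut_le (n := n) (m := m) he (t := 4 * l) (L := L) (by linarith)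
  rw [e2] at p1 p4 p5 p6 p7 p8
  rw [e3] at p2 p3
  rw [e4] at p9
  have hsplit : ENNReal.ofReal (11 / (m : ℝ) ^ 2) = ENNReal.ofReal (1 / (m : ℝ) ^ 2) +
      (ENNReal.ofReal (1 / (m : ℝ) ^ 2) + (ENNReal.ofReal (1 / (m : ℝ) ^ 2) +
      (ENNReal.ofReal (1 / (m : ℝ) ^ 2) + (ENNReal.ofReal (2 * (1 / (m : ℝ) ^ 2)) +
      (ENNReal.ofReal (2 * (1 / (m : ℝ) ^ 2)) + (ENNReal.ofReal (1 / (m : ℝ) ^ 2) +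
      (ENNReal.ofReal (1 / (m : ℝ) ^ 2) + ENNReal.ofReal (1 / (m : ℝ) ^ 2)))))))) := by
    have h0 : (0 : ℝ) ≤ 1 / (m : ℝ) ^ 2 := by positivity
    rw [show (11 / (m : ℝ) ^ 2) = 11 * (1 / (m : ℝ) ^ 2) by ring]
    generalize 1 / (m : ℝ) ^ 2 = d at h0
    repeat rw [← ENNReal.ofReal_add (by positivity) (by positivity)]
    congr 1
    ring
  rw [hsplit]
  refine le_trans (measure_mono ?_) ((measure_union_le _ _).trans (add_le_add p1
    ((measure_union_le _ _).trans (add_le_add p2 ((measure_union_le _ _).trans (add_le_add p3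
    ((measure_union_le _ _).trans (add_le_add p4 ((measure_union_le _ _).trans (add_le_add p5
    ((measure_union_le _ _).trans (add_le_add p6 ((measure_union_le _ _).trans (add_le_add p7
    ((measure_union_le _ _).trans (add_le_add p8 p9))))))))))))))))
  intro a ha
  by_contra hcon
  simp only [mem_union, not_or, mem_ofPred_eq, not_and, not_not] at hcon ha
  obtain ⟨q1, q2, q3, q4, q5, q6, q7, q8, q9⟩ := hcon
  exact ha ⟨q1, q2, q4 q2, q5, q6, q3, q7 q2 q5, q8 (q4 q2), q9⟩

/-- The smallness conditions hold once `m ≥ C n log n` with `C` large. -/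
lemma exists_sampling_constant {δ : ℝ} (hδ : 0 < δ) : ∃ C : ℝ, 0 < C ∧ ∀ n m : ℕ, 3 ≤ n →
    C * n * Real.log n ≤ m → 1 ≤ Real.log m ∧ Real.log m * (n + Real.log m) ≤ δ * m ∧
      Real.log m ^ 4 ≤ δ * m := by
  set c := δ / 3 with hc
  have hc0 : 0 < c := by positivity
  -- The eighth power gives `log⁴ m ≤ c √m`, which settles the case `n ≤ √m` below. When `n ≥ √m`,
  -- `log m ≤ 2 log n` and the sampling hypothesis applies directly.
  have hlo := (Real.isLittleO_pow_log_id_atTop (n := 8)).def (show 0 < c ^ 2 by positivity)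
  obtain ⟨x₀, hx₀⟩ := Filter.eventually_atTop.1 hlo
  refine ⟨max (max x₀ 3) (1 / c), by positivity, fun n m hn hm => ?_⟩
  set C := max (max x₀ 3) (1 / c) with hC
  have hn' : (3 : ℝ) ≤ n := by exact_mod_cast hn
  have hexp3 : Real.exp 1 ≤ 3 := by linarith [Real.exp_one_lt_d9]
  have hlogn : 1 ≤ Real.log n := by
    rw [Real.le_log_iff_exp_le (by linarith)]
    linarith
  have hC0 : 0 < C := by positivity
  have hC3 : 3 ≤ C := (le_max_right _ _).trans (le_max_left _ _)
  have hCx : x₀ ≤ C := (le_max_left _ _).trans (le_max_left _ _)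
  have hCc : 1 ≤ C * c := by
    have : 1 / c ≤ C := le_max_right _ _
    rwa [div_le_iff₀ hc0] at this
  have hnl : 1 ≤ n * Real.log n := by nlinarith
  have hmC : C ≤ m := by
    refine le_trans ?_ hm
    rw [mul_assoc]
    exact le_mul_of_one_le_right hC0.le hnl
  have hm0 : (0 : ℝ) < m := by linarith
  have hl1 : 1 ≤ Real.log m := by
    rw [Real.le_log_iff_exp_le hm0]
    linarith
  set l := Real.log m with hl
  have h8 : l ^ 8 ≤ c ^ 2 * m := by
    have := hx₀ m (hCx.trans hmC)
    rw [id_eq, Real.norm_of_nonneg (by positivity), Real.norm_of_nonneg hm0.le] at this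
    exact this
  have hsm : 1 ≤ √(m : ℝ) := Real.one_le_sqrt.2 (by linarith)
  have hsq : √(m : ℝ) * √m = m := Real.mul_self_sqrt hm0.le
  have h4 : l ^ 4 ≤ c * √m := by
    refine le_of_sq_le_sq ?_ (by positivity)
    rw [mul_pow, Real.sq_sqrt hm0.le]
    refine le_trans (le_of_eq ?_) h8
    ring
  have hl4 : l ≤ l ^ 4 := le_self_pow₀ hl1 (by norm_num)
  have hl2 : l * l ≤ l ^ 4 := by
    rw [← sq]
    exact pow_le_pow_right₀ hl1 (by norm_num)
  have hsm2 : √(m : ℝ) ≤ m := by nlinarith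
  have h4m : l ^ 4 ≤ c * m := h4.trans (by gcongr)
  have hln : l * n ≤ 2 * c * m := by
    rcases le_total (n : ℝ) √m with h | h
    · calc l * n ≤ (c * √m) * √m := mul_le_mul (hl4.trans h4) h (by positivity) (by positivity)
        _ = c * m := by rw [mul_assoc, hsq]
        _ ≤ 2 * c * m := by nlinarith [mul_pos hc0 hm0]
    · have hmn : (m : ℝ) ≤ (n : ℝ) ^ 2 := by
        rw [← hsq, ← sq]
        exact pow_le_pow_left₀ (by positivity) h 2
      have h5 : l ≤ 2 * Real.log n := by
        have := Real.log_le_log hm0 hmn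
        rwa [Real.log_pow] at this
      have h6 : n * Real.log n ≤ c * m := by
        have h7 : 1 * (n * Real.log n) ≤ C * c * (n * Real.log n) := by gcongr
        calc n * Real.log n ≤ c * (C * n * Real.log n) := by linarith
          _ ≤ c * m := by gcongr
      calc l * n ≤ 2 * Real.log n * n := by gcongr
        _ ≤ 2 * c * m := by linarith
  have hδc : δ = 3 * c := by rw [hc]; ring
  refine ⟨hl1, ?_, ?_⟩
  · rw [hδc]
    linarith
  · rw [hδc]
    nlinarith [mul_pos hc0 hm0]

lemma sqrt_mul_pow_le_one {H : ℝ} (hH : H ≤ m) (hm : 21 ≤ m) : √H * (9 / 11) ^ m ≤ 1 := by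
  have hm' : (21 : ℝ) ≤ m := by exact_mod_cast hm
  have h1 : 1 + (m : ℝ) * (2 / 9) ≤ (1 + 2 / 9) ^ m :=
    one_add_mul_le_pow (by norm_num) m
  have h2 : √H ≤ (11 / 9) ^ m := by
    rw [show (11 / 9 : ℝ) = 1 + 2 / 9 by norm_num]
    refine le_trans (Real.sqrt_le_iff.2 ⟨by positivity, ?_⟩) h1
    nlinarith
  calc √H * (9 / 11) ^ m ≤ (11 / 9) ^ m * (9 / 11) ^ m := by gcongr
    _ = 1 := by rw [← mul_pow]; norm_num

/-- `S` is not assumed measurable and `A` is only almost everywhere measurable, so the event removes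
measurable hulls of `Sᶜ` and of the set where `A` differs from its measurable version. -/
lemma exists_event_of_map_eq {Ω X : Type*} [MeasurableSpace Ω] [MeasurableSpace X] {P : Measure Ω}
    [IsProbabilityMeasure P] {A : Ω → X} (hA : AEMeasurable A P) {S : Set X} {δ : ℝ} (hδ : 0 ≤ δ)
    (hS : P.map A Sᶜ ≤ ENNReal.ofReal δ) :
    ∃ G : Set Ω, MeasurableSet G ∧ 1 - δ ≤ P.real G ∧ ∀ ω ∈ G, A ω ∈ S := by
  set B := toMeasurable (P.map A) Sᶜ with hB
  set N := toMeasurable P {ω | ¬ A ω = hA.mk A ω} with hN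
  have hBm : MeasurableSet B := measurableSet_toMeasurable _ _
  have hNm : MeasurableSet N := measurableSet_toMeasurable _ _
  have hGm : MeasurableSet (hA.mk A ⁻¹' B ∪ N) := (hA.measurable_mk hBm).union hNm
  refine ⟨(hA.mk A ⁻¹' B ∪ N)ᶜ, hGm.compl, ?_, fun ω hω => ?_⟩
  · rw [probReal_compl_eq_one_sub hGm]
    have h1 : P (hA.mk A ⁻¹' B ∪ N) ≤ ENNReal.ofReal δ := by
      refine (measure_union_le _ _).trans ?_
      have h2 : P N = 0 := by
        rw [hN, measure_toMeasurable]
        exact hA.ae_eq_mk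
      rw [h2, add_zero, ← Measure.map_apply hA.measurable_mk hBm, ← Measure.map_congr hA.ae_eq_mk,
        hB, measure_toMeasurable]
      exact hS
    have h3 := ENNReal.toReal_le_of_le_ofReal hδ h1
    rw [measureReal_def]
    linarith
  · simp only [mem_compl_iff, mem_union, mem_preimage, not_or] at hω
    have h1 : A ω = hA.mk A ω := by
      by_contra hne
      exact hω.2 (subset_toMeasurable _ _ hne)
    by_contra hne
    apply hω.1
    rw [← h1]
    exact subset_toMeasurable _ _ hne

lemma spectralInit_zero {a : Fin m → EuclideanSpace ℝ (Fin n)} {x₀ : EuclideanSpace ℝ (Fin n)}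
    (h : IsSpectralInit a (measurements a 0) x₀) : x₀ = 0 := by
  obtain ⟨u, -, -, rfl⟩ := h
  simp [spectralScale, measurements]

/-- The three claims for a spectral initialiser, from the quantitative estimates. -/
lemma claims_of_estimates {xbar x₀ : EuclideanSpace ℝ (Fin n)}
    {a : Fin m → EuclideanSpace ℝ (Fin n)} {ϱ : ℝ} (hϱ : ϱ ∈ Ioo (0 : ℝ) 1) (hx : xbar ≠ 0) {κ : ℝ}
    (hκ0 : 0 ≤ κ) (hκ : 100 * κ ≤ eta1 ϱ) (hd : distTrue xbar x₀ ≤ κ * ‖xbar‖)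
    (ho : objective a (measurements a xbar) x₀ ≤ (200 * κ) ^ 2 * ‖xbar‖ ^ 4) :
    distTrue xbar x₀ ≤ eta1 ϱ * ‖xbar‖ ∧
      objective a (measurements a xbar) x₀ ≤ (3 + ϱ * max (‖xbar‖ ^ 2 / 3) 1) *
        (Theta xbar (eta1 ϱ * ‖xbar‖) / 2) * eta1 ϱ ^ 2 * ‖xbar‖ ^ 2 ∧
      (xbar ≠ 0 → ∀ lam : ℝ, lam ∈ Ioo (0 : ℝ) 1 → ϱ ≤ eta1Inv (initThreshold xbar lam) →
        x₀ ∈ ballTrue xbar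
          (localRadius xbar lam / max √(Theta xbar (localRadius xbar lam)) 1)) := by
  have hη := eta1_pos hϱ
  have hdist : distTrue xbar x₀ ≤ eta1 ϱ * ‖xbar‖ := hd.trans (by
    gcongr
    linarith)
  refine ⟨hdist, ?_, fun _ lam hlam hle => ?_⟩
  · have hΘ := le_Theta hx (ρ := eta1 ϱ * ‖xbar‖) (by positivity)
    have h1 : 3 ≤ 3 + ϱ * max (‖xbar‖ ^ 2 / 3) 1 := by
      have := hϱ.1
      have : 0 ≤ ϱ * max (‖xbar‖ ^ 2 / 3) 1 := by positivity
      linarith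
    calc objective a (measurements a xbar) x₀ ≤ (200 * κ) ^ 2 * ‖xbar‖ ^ 4 := ho
      _ ≤ (2 * eta1 ϱ) ^ 2 * ‖xbar‖ ^ 4 := by
          refine mul_le_mul_of_nonneg_right (pow_le_pow_left₀ (by positivity) ?_ 2) (by positivity)
          linarith
      -- 4 ≤ 9/2; the last step then uses `Theta ≥ 3 ‖xbar‖²` and discards the `ϱ` term.
      _ ≤ 3 * (3 * ‖xbar‖ ^ 2 / 2) * eta1 ϱ ^ 2 * ‖xbar‖ ^ 2 := by
          have : 0 ≤ eta1 ϱ ^ 2 * ‖xbar‖ ^ 4 := by positivity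
          nlinarith
      _ ≤ _ := by
          gcongr
          linarith
  · refine lt_of_le_of_lt hdist (lt_of_le_of_lt ?_ (initThreshold_mul_norm_lt hx hlam))
    gcongr
    exact eta1_le_of_le_eta1Inv hϱ (initThreshold_mem xbar hlam) hle

end Conclusion

end PhaseRetrieval

end

theorem mainTheorem10 :
    StrictMonoOn PhaseRetrieval.eta1 (Ioo 0 1) ∧
    BijOn PhaseRetrieval.eta1 (Ioo 0 1) (Ioo 0 (√2 + 1 / 2)) ∧
    ∃ ζ : ℝ, 0 < ζ ∧ ∀ ϱ : ℝ, ϱ ∈ Ioo (0 : ℝ) 1 → ∃ C : ℝ, 0 < C ∧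
      ∀ (n m : ℕ) (xbar : EuclideanSpace ℝ (Fin n)),
        C * (n : ℝ) * Real.log n ≤ (m : ℝ) →
        ∀ (Ω : Type*) (_ : MeasurableSpace Ω) (P : Measure Ω) (_ : IsProbabilityMeasure P)
          (a : Fin m → Ω → EuclideanSpace ℝ (Fin n)),
          (∀ r, HasLaw (a r) (stdGaussian (EuclideanSpace ℝ (Fin n))) P) →
          iIndepFun a P →
          ∃ G : Set Ω, MeasurableSet G ∧
            1 - 2 * Real.exp (-((m : ℝ) * (√(1 + ϱ) - 1) ^ 2 / 8))
                - 5 * Real.exp (-(ζ * (n : ℝ))) - 4 / (n : ℝ) ^ 2 ≤ P.real G ∧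
            ∀ ω ∈ G, ∀ x₀ : EuclideanSpace ℝ (Fin n),
              PhaseRetrieval.IsSpectralInit (fun r => a r ω)
                (PhaseRetrieval.measurements (fun r => a r ω) xbar) x₀ →
              PhaseRetrieval.distTrue xbar x₀ ≤ PhaseRetrieval.eta1 ϱ * ‖xbar‖ ∧
              PhaseRetrieval.objective (fun r => a r ω)
                  (PhaseRetrieval.measurements (fun r => a r ω) xbar) x₀ ≤
                (3 + ϱ * max (‖xbar‖ ^ 2 / 3) 1) *
                  (PhaseRetrieval.Theta xbar (PhaseRetrieval.eta1 ϱ * ‖xbar‖) / 2) *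
                  PhaseRetrieval.eta1 ϱ ^ 2 * ‖xbar‖ ^ 2 ∧
              (xbar ≠ 0 → ∀ lam : ℝ, lam ∈ Ioo (0 : ℝ) 1 →
                ϱ ≤ PhaseRetrieval.eta1Inv (PhaseRetrieval.initThreshold xbar lam) →
                x₀ ∈ PhaseRetrieval.ballTrue xbar
                  (PhaseRetrieval.localRadius xbar lam /
                    max √(PhaseRetrieval.Theta xbar (PhaseRetrieval.localRadius xbar lam)) 1)) := by
  refine ⟨PhaseRetrieval.eta1_strictMonoOn, PhaseRetrieval.eta1_bijOn, 1, one_pos, fun ϱ hϱ => ?_⟩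
  have hη := PhaseRetrieval.eta1_pos hϱ
  -- With `ε = g` the relative error is `κ = 15 g`, and 1500 = 15 · 100 gives `100 κ ≤ η₁(ϱ)`.
  set g := min (1 / 24) (PhaseRetrieval.eta1 ϱ / 1500) with hg
  have hg0 : 0 < g := by positivity
  have hg24 : g ≤ 1 / 24 := min_le_left _ _
  have hgη : g ≤ PhaseRetrieval.eta1 ϱ / 1500 := min_le_right _ _
  have hg1 : g ^ 2 ≤ 1 := pow_le_one₀ hg0.le (by linarith)
  -- The factor 10⁷ is dictated mainly by `√L W ≤ g`, where `200² · 18 · (5 (n + 2 l) + 1) l` must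
  -- stay below `g² m`.
  obtain ⟨C, hC, hcond⟩ := PhaseRetrieval.exists_sampling_constant
    (δ := g ^ 2 / 10000000) (by positivity)
  refine ⟨C, hC, fun n m xbar hm Ω _ P _ a ha hind => ?_⟩
  rcases lt_or_ge n 3 with hn | hn
  -- For `n ≤ 2` the claimed probability is not positive: at `n = 0` (where `4 / 0 = 0`) because of
  -- the term 5, otherwise because `4 / n² ≥ 1`.
  · refine ⟨∅, MeasurableSet.empty, ?_, fun ω hω => absurd hω (notMem_empty ω)⟩
    rw [measureReal_empty]
    have h1 := Real.exp_pos (-((m : ℝ) * (√(1 + ϱ) - 1) ^ 2 / 8))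
    have h2 := Real.exp_pos (-(1 * (n : ℝ)))
    interval_cases n
    · norm_num at h1 ⊢
      linarith
    · norm_num at h1 h2 ⊢
      linarith
    · norm_num at h1 h2 ⊢
      linarith
  have hn' : (3 : ℝ) ≤ n := by exact_mod_cast hn
  rcases eq_or_ne xbar 0 with rfl | hx
  · refine ⟨univ, MeasurableSet.univ, ?_, fun ω _ x₀ hx₀ => ?_⟩
    · rw [probReal_univ]
      have h1 := Real.exp_pos (-((m : ℝ) * (√(1 + ϱ) - 1) ^ 2 / 8))
      have h2 := Real.exp_pos (-(1 * (n : ℝ)))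
      have h3 : 0 ≤ 4 / (n : ℝ) ^ 2 := by positivity
      linarith
    · obtain rfl := PhaseRetrieval.spectralInit_zero hx₀
      refine ⟨by simp [PhaseRetrieval.distTrue], ?_, fun h => absurd rfl h⟩
      simp [PhaseRetrieval.objective, PhaseRetrieval.measurements]
  obtain ⟨hl, h1, h2⟩ := hcond n m hn hm
  set l := Real.log m with hldef
  have hR : 0 < ‖xbar‖ := norm_pos_iff.2 hx
  set e := ‖xbar‖⁻¹ • xbar with he
  have he1 : ‖e‖ = 1 := by
    rw [he, norm_smul, norm_inv, norm_norm, inv_mul_cancel₀ hR.ne']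
  have hxe : ‖xbar‖ • e = xbar := by
    rw [he, smul_smul, mul_inv_cancel₀ hR.ne', one_smul]
  have hm0 : (0 : ℝ) ≤ m := by positivity
  have h1' : 10000000 * (l * (n + l)) ≤ g ^ 2 * m := by linarith
  have hgm : g ^ 2 * m ≤ m := mul_le_of_le_one_left hm0 hg1
  have hln : (n : ℝ) ≤ l * n := le_mul_of_one_le_left (by linarith) hl
  have hll : l ≤ l * l := le_mul_of_one_le_left (by linarith) hl
  have hmn : 10000000 * (n : ℝ) ≤ m := by nlinarith
  have hmpos : 0 < m := by
    have : (0 : ℝ) < m := by linarith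
    exact_mod_cast this
  have hm' : (0 : ℝ) < m := by exact_mod_cast hmpos
  have hbad := PhaseRetrieval.measure_not_isGood_le he1 (ε := g) (by omega) hmpos hg0 hg24 hl
    (h1'.trans hgm) (by nlinarith) (by linarith)
  have hmeas : AEMeasurable (fun ω r => a r ω) P :=
    aemeasurable_pi_lambda _ fun r => (ha r).aemeasurable
  have hmap : P.map (fun ω r => a r ω) =
      Measure.pi fun _ : Fin m => stdGaussian (EuclideanSpace ℝ (Fin n)) := by
    rw [(iIndepFun_iff_map_fun_eq_pi_map fun r => (ha r).aemeasurable).1 hind]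
    congr 1
    funext r
    exact (ha r).map_eq
  obtain ⟨G, hGm, hGp, hG⟩ := PhaseRetrieval.exists_event_of_map_eq hmeas
    (S := {b | PhaseRetrieval.IsGood e b g (18 * l) (12 * (n + l))
      (200 * √((5 * (n + 2 * l) + 1) / m))}) (δ := 11 / (m : ℝ) ^ 2) (by positivity)
    (by rw [hmap]; exact hbad)
  refine ⟨G, hGm, ?_, fun ω hω x₀ hx₀ => ?_⟩
  · refine le_trans ?_ hGp
    have h3 := Real.exp_pos (-((m : ℝ) * (√(1 + ϱ) - 1) ^ 2 / 8))
    have h4 := Real.exp_pos (-(1 * (n : ℝ)))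
    -- Since `m ≥ 2 n`, the whole failure probability fits in the polynomial term, and the value of
    -- `ζ` plays no role here.
    have h5 : 11 / (m : ℝ) ^ 2 ≤ 4 / (n : ℝ) ^ 2 := by
      rw [div_le_div_iff₀ (by positivity) (by positivity)]
      have h6 : (2 * (n : ℝ)) ^ 2 ≤ (m : ℝ) ^ 2 := pow_le_pow_left₀ (by positivity) (by linarith) 2
      nlinarith
    linarith
  · have hgood : PhaseRetrieval.IsGood e (fun r => a r ω) g (18 * l) (12 * (n + l))
      (200 * √((5 * (n + 2 * l) + 1) / m)) := hG ω hω
    have hln0 : 0 ≤ l * n := by positivity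
    have hest := hgood.spectralInit he1 hR (by omega) (g := g) (by linarith) ?_ ?_ ?_ hg24
      (by linarith) (PhaseRetrieval.sqrt_mul_pow_le_one ?_ ?_) (x₀ := x₀) (by rwa [hxe])
    · rw [hxe] at hest
      exact PhaseRetrieval.claims_of_estimates hϱ hx (κ := 3 * g + 12 * g) (by positivity)
        (by linarith) hest.1 hest.2
    · nlinarith
    · have h7 : √(18 * l) * (200 * √((5 * (n + 2 * l) + 1) / m)) =
          √(200 ^ 2 * (18 * l * ((5 * (n + 2 * l) + 1) / m))) := by
        rw [Real.sqrt_mul (sq_nonneg (200 : ℝ)), Real.sqrt_sq (by norm_num),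
          Real.sqrt_mul (show (0 : ℝ) ≤ 18 * l by positivity)]
        ring
      rw [h7]
      refine Real.sqrt_le_iff.2 ⟨hg0.le, ?_⟩
      rw [← mul_div_assoc, ← mul_div_assoc, div_le_iff₀ hm']
      nlinarith
    · rw [div_le_iff₀ hm']
      nlinarith
    · nlinarith
    · have : (21 : ℝ) ≤ m := by linarith
      exact_mod_cast this
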